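/- Let $g\colon\mathbb{D}\to\mathbb{D}$ be an inner function, i.e. a holomorphic self-map of the open unit disk whose radial limits exist and have modulus one at Lebesgue almost every point of $\partial\mathbb{D}$. Let $E(g)\subset\partial\mathbb{D}$ be the set of its singularities, i.e. of the points of $\partial\mathbb{D}$ to no neighbourhood of which $g$ can be continued analytically, and regard $g$ as its maximal meromorphic extension $g\colon\widehat{\mathbb{C}}\smallsetminus E(g)\to\widehat{\mathbb{C}}$, given by analytic continuation on $\partial\mathbb{D}\smallsetminus E(g)$ and by Schwarz reflection outside $\overline{\mathbb{D}}$. For an open set $D\subset\widehat{\mathbb{C}}$, all inverse branches of $g$ are said to be well defined in $D$ if for every $z\in\widehat{\mathbb{C}}\smallsetminus E(g)$ with $g(z)\in D$ there is a holomorphic map $G_1\colon D\to\widehat{\mathbb{C}}\smallsetminus E(g)$ with $g\circ G_1=\mathrm{id}_D$ and $G_1(g(z))=z$. A value $v\in\widehat{\mathbb{C}}$ is regular if there is $r>0$ such that all inverse branches of $g$ are well defined in the disk $D(v,r)$ (taken in the chart $1/z$ if $v=\infty$), and singular otherwise; $SV(g)$ denotes the set of singular values. A non-degenerate crosscut is an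 open Jordan arc $C\subset\mathbb{D}$ with $\overline{C}=C\cup\{a,b\}$, where $a,b\in\partial\mathbb{D}$, $a\neq b$. A crosscut neighbourhood of $\xi\in\partial\mathbb{D}$ is a connected component $N_C$ of $\mathbb{D}\smallsetminus C$, for some non-degenerate crosscut $C$, such that $\xi\in\partial N_C$ and $\xi$ is not an endpoint of $C$. **Proposition.** Let $g\colon\mathbb{D}\to\mathbb{D}$ be an inner function and let $\xi\in\partial\mathbb{D}$. The following are equivalent. (a) There exists a crosscut neighbourhood $N_C$ of $\xi$ such that $SV(g)\cap N_C=\emptyset$. (b) $\xi$ is a regular value of $g$, i.e. there exists $\rho>0$ such that all inverse branches of $g$ are well defined in $D(\xi,\rho)$. -/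

import Mathlib

open Set Filter Topology OnePoint

noncomputable section

/-! The Riemann sphere is the one-point compactification `OnePoint ℂ`, with its Mathlib topology. -/

namespace Sphere

/-- A holomorphic parametrization of a neighbourhood of `p` in the Riemann sphere, centred at `p`:
`t ↦ a + t` when `p = a` is finite, and `t ↦ 1 / t` (with `0 ↦ ∞`) when `p = ∞`. -/
def param (p : OnePoint ℂ) (t : ℂ) : OnePoint ℂ :=
  p.elim (if t = 0 then ∞ else ((t⁻¹ : ℂ) : OnePoint ℂ)) (fun a => ((a + t : ℂ) : OnePoint ℂ))

/-- The complex coordinate at `q` in the Riemann sphere, inverse to `param q` near `q`: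
`w ↦ w - b` when `q = b` is finite, and `w ↦ 1 / w` (with `∞ ↦ 0`) when `q = ∞`.
The values at `∞` in the first case and at `0` in the second case play no role. -/
def coord (q p : OnePoint ℂ) : ℂ :=
  q.elim (p.elim 0 (fun w => w⁻¹)) (fun b => p.elim 0 (fun w => w - b))

/-- A map of the Riemann sphere is holomorphic at `p` if it is continuous at `p` and analytic
in the coordinates centred at `p` and at its image. -/
def HolomorphicAt (f : OnePoint ℂ → OnePoint ℂ) (p : OnePoint ℂ) : Prop :=
  ContinuousAt f p ∧ AnalyticAt ℂ (fun t : ℂ => coord (f p) (f (param p t))) 0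

/-- The disk `D(v, r)`: the Euclidean disk if `v` is finite, and the disk of radius `r` in the
coordinate `1 / z` if `v = ∞`. -/
def disk (v : OnePoint ℂ) (r : ℝ) : Set (OnePoint ℂ) :=
  v.elim (insert ∞ ((fun z : ℂ => (z : OnePoint ℂ)) '' {z : ℂ | r⁻¹ < ‖z‖}))
    (fun a => (fun z : ℂ => (z : OnePoint ℂ)) '' Metric.ball a r)

/-- `G` is a branch on `D` of the inverse of the map `f : Ω → OnePoint ℂ`. -/
structure IsInverseBranch (Ω : Set (OnePoint ℂ)) (f : OnePoint ℂ → OnePoint ℂ)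
    (D : Set (OnePoint ℂ)) (G : OnePoint ℂ → OnePoint ℂ) : Prop where
  holomorphic : ∀ w ∈ D, HolomorphicAt G w
  mapsTo : MapsTo G D Ω
  right_inv : ∀ w ∈ D, f (G w) = w

/-- All branches of the inverse of `f : Ω → OnePoint ℂ` are well defined in `D`: whenever
`f z = w` with `z ∈ Ω` and `w ∈ D`, there is a branch of the inverse, defined in the whole
of `D`, which sends `w` to `z`. -/
def AllInverseBranchesDefined (Ω : Set (OnePoint ℂ)) (f : OnePoint ℂ → OnePoint ℂ)
    (D : Set (OnePoint ℂ)) : Prop :=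
  ∀ z ∈ Ω, f z ∈ D → ∃ G : OnePoint ℂ → OnePoint ℂ, IsInverseBranch Ω f D G ∧ G (f z) = z

/-- `v` is a regular value of `f : Ω → OnePoint ℂ`. -/
def IsRegularValue (Ω : Set (OnePoint ℂ)) (f : OnePoint ℂ → OnePoint ℂ) (v : OnePoint ℂ) : Prop :=
  ∃ r : ℝ, 0 < r ∧ AllInverseBranchesDefined Ω f (disk v r)

/-- The set of singular values of `f : Ω → OnePoint ℂ`. -/
def singularValues (Ω : Set (OnePoint ℂ)) (f : OnePoint ℂ → OnePoint ℂ) : Set (OnePoint ℂ) :=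
  {v | ¬ IsRegularValue Ω f v}

/-- Reflection of a complex number in the unit circle, `w ↦ 1 / conj w`, with `0 ↦ ∞`. -/
def reflect (w : ℂ) : OnePoint ℂ :=
  if w = 0 then ∞ else (((starRingEnd ℂ w)⁻¹ : ℂ) : OnePoint ℂ)

end Sphere

/-- `g` (its values in the unit disk are the only relevant ones) is an inner function: a
holomorphic self-map of the open unit disk which has at Lebesgue almost every point `exp (i θ)`
of the unit circle a radial limit of modulus one. -/
structure IsInner (g : ℂ → ℂ) : Prop where
  differentiableOn : DifferentiableOn ℂ g (Metric.ball 0 1)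
  mapsTo : MapsTo g (Metric.ball 0 1) (Metric.ball 0 1)
  radial : ∀ᵐ θ : ℝ, ∃ w : ℂ, ‖w‖ = 1 ∧
    Tendsto (fun r : ℝ => g ((r : ℂ) * Complex.exp ((θ : ℂ) * Complex.I))) (𝓝[<] 1) (𝓝 w)

namespace InnerFun

/-- The set `E(g)` of singularities of `g`: the points of the unit circle to no neighbourhood of
which `g` (defined in the unit disk) can be continued analytically. -/
def singularities (g : ℂ → ℂ) : Set ℂ :=
  {ζ | ‖ζ‖ = 1 ∧ ¬ ∃ h : ℂ → ℂ, AnalyticAt ℂ h ζ ∧ h =ᶠ[𝓝[Metric.ball 0 1] ζ] g}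

/-- The domain of the maximal meromorphic extension of `g`: the sphere without `E(g)`. -/
def extDomain (g : ℂ → ℂ) : Set (OnePoint ℂ) :=
  ((fun z : ℂ => (z : OnePoint ℂ)) '' singularities g)ᶜ

/-- The maximal meromorphic extension of `g`: `g` itself in the unit disk, the limit of `g` from
within the disk on the unit circle (outside `E(g)` this is the value of the analytic continuation;
the values on `E(g)` play no role), and the Schwarz reflection of `g` outside the closed disk. -/
def ext (g : ℂ → ℂ) (p : OnePoint ℂ) : OnePoint ℂ :=
  p.elim (Sphere.reflect (g 0)) (fun z =>
    if ‖z‖ < 1 then ((g z : ℂ) : OnePoint ℂ)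
    else if ‖z‖ = 1 then ((extendFrom (Metric.ball 0 1) g z : ℂ) : OnePoint ℂ)
    else Sphere.reflect (g (starRingEnd ℂ z)⁻¹))

/-- The set `SV(g)` of singular values of (the maximal meromorphic extension of) `g`. -/
def SV (g : ℂ → ℂ) : Set (OnePoint ℂ) := Sphere.singularValues (extDomain g) (ext g)

/-- All inverse branches of (the maximal meromorphic extension of) `g` are well defined in `D`. -/
def AllInverseBranchesDefined (g : ℂ → ℂ) (D : Set (OnePoint ℂ)) : Prop :=
  Sphere.AllInverseBranchesDefined (extDomain g) (ext g) D

end InnerFun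

/-- `C` is a crosscut of the unit disk with endpoints `a` and `b`: an open Jordan arc in the disk
landing at the points `a` and `b` of the unit circle, non-degenerate in the sense that `a ≠ b`. -/
def IsCrosscut (C : Set ℂ) (a b : ℂ) : Prop :=
  ‖a‖ = 1 ∧ ‖b‖ = 1 ∧ a ≠ b ∧ C ⊆ Metric.ball 0 1 ∧
    ∃ γ : ℝ → ℂ, ContinuousOn γ (Icc 0 1) ∧ InjOn γ (Icc 0 1) ∧
      γ 0 = a ∧ γ 1 = b ∧ γ '' Ioo 0 1 = C

/-- `N` is a crosscut neighbourhood of the point `ξ` of the unit circle: a domain in the unit disk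
whose boundary in the disk is a crosscut `C` (that is, a connected component of the complement
of `C` in the disk), having on its boundary the point `ξ`, which is not an endpoint of `C`. -/
def IsCrosscutNhd (N : Set ℂ) (ξ : ℂ) : Prop :=
  IsOpen N ∧ IsConnected N ∧ N ⊆ Metric.ball 0 1 ∧ ξ ∈ frontier N ∧
    ∃ a b : ℂ, IsCrosscut (frontier N ∩ Metric.ball 0 1) a b ∧ ξ ≠ a ∧ ξ ≠ b

end

/-!
The substance is that `ξ` is a regular value as soon as all values in the unit disk close to `ξ`
are regular; the converse holds because the caps cut off by chords are crosscut neighbourhoods.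

Let `W` be the part of the unit disk in a small disk around `ξ`. It is convex, and `g` is a covering
over `W`, so all inverse branches `G : W → 𝔻` exist by monodromy (`exists_inverse_on_convex`).
Here the extension of `g` takes values in the unit disk only inside the unit disk, because its
values on the unit circle have modulus one (`IsInner.norm_continuation_eq_one`).

The Schwarz–Pick lemma gives `κ (1 - ‖z‖) ≤ 1 - ‖g z‖`, with `κ` depending on `g 0` only. For a
branch this reads `1 - ‖G w‖ ≤ (1 - ‖w‖) / κ`. Together with the infinitesimal Schwarz–Pick lemma
`‖G' w‖ ≤ 2 (1 - ‖G w‖) / (1 - ‖w‖)` it makes `G` Lipschitz, so that `G` is continuous up to the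
unit circle, where it has modulus one; and it keeps the zeros of `G` away from `ξ`. Hence `G`
extends by reflection, holomorphically by Morera's theorem, to a disk `D(ξ, ρ)` with `ρ` independent
of the branch (`exists_reflection`).

At a point `ζ` of the circle the extended branch has non-zero derivative, by the Hopf lemma
(`deriv_ne_zero_of_norm_eq_one`), and its local inverse continues `g` analytically; so the value
at `ζ` is not a singularity of `g`, and the extended branch is a branch of the inverse of the
meromorphic extension of `g` (`IsReflectedBranch.isInverseBranch`). Finally a branch passes through
every given point above `D(ξ, ρ)`: for points of the unit circle this follows from the identity
theorem, and outside the closed disk by symmetry.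
-/

/-! ### The Schwarz–Pick lemma on a disk -/

/-- The identity behind the invariance of the unit disk under Möbius transformations. -/
theorem sq_norm_one_sub_conj_mul_sub (a b : ℂ) :
    ‖1 - starRingEnd ℂ a * b‖ ^ 2 - ‖b - a‖ ^ 2 = (1 - ‖a‖ ^ 2) * (1 - ‖b‖ ^ 2) := by
  simp only [Complex.sq_norm, Complex.normSq_apply, Complex.sub_re, Complex.sub_im,
    Complex.mul_re, Complex.mul_im, Complex.conj_re, Complex.conj_im, Complex.one_re,
    Complex.one_im]
  ring

theorem one_sub_conj_mul_ne_zero {a b : ℂ} (ha : ‖a‖ < 1) (hb : ‖b‖ < 1) :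
    1 - starRingEnd ℂ a * b ≠ 0 := by
  intro h
  have h1 : ‖starRingEnd ℂ a * b‖ = 1 := by
    rw [← sub_eq_zero.mp h, norm_one]
  rw [norm_mul, RCLike.norm_conj] at h1
  nlinarith [norm_nonneg a, norm_nonneg b]

/-- The **Schwarz–Pick lemma**, with the centre of the disk as one of the two points. -/
theorem schwarzPick {f : ℂ → ℂ} {c z : ℂ} {R : ℝ}
    (hd : DifferentiableOn ℂ f (Metric.ball c R))
    (hm : MapsTo f (Metric.ball c R) (Metric.ball 0 1)) (hz : z ∈ Metric.ball c R) :
    ‖f z - f c‖ ≤ ‖1 - starRingEnd ℂ (f c) * f z‖ * (‖z - c‖ / R) := by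
  have hR : 0 < R := Metric.nonempty_ball.1 ⟨z, hz⟩
  have hn : ∀ w ∈ Metric.ball c R, ‖f w‖ < 1 := fun w hw => by simpa using hm hw
  have hc := hn c (Metric.mem_ball_self hR)
  have hne : ∀ w ∈ Metric.ball c R, 1 - starRingEnd ℂ (f c) * f w ≠ 0 := fun w hw =>
    one_sub_conj_mul_ne_zero hc (hn w hw)
  let φ : ℂ → ℂ := fun w => (f w - f c) / (1 - starRingEnd ℂ (f c) * f w)
  have hφc : φ c = 0 := by simp [φ]
  have hφ : DifferentiableOn ℂ φ (Metric.ball c R) :=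
    (hd.sub_const _).div ((hd.const_mul _).const_sub _) hne
  have hφm : MapsTo φ (Metric.ball c R) (Metric.closedBall (φ c) 1) := by
    intro w hw
    rw [hφc, mem_closedBall_zero_iff, norm_div]
    refine div_le_one_of_le₀ ?_ (norm_nonneg _)
    refine abs_le_of_sq_le_sq' ?_ (norm_nonneg _) |>.2
    have h1 := sq_norm_one_sub_conj_mul_sub (f c) (f w)
    have h2 : 0 ≤ (1 - ‖f c‖ ^ 2) * (1 - ‖f w‖ ^ 2) :=
      mul_nonneg (by nlinarith [norm_nonneg (f c)]) (by nlinarith [norm_nonneg (f w), hn w hw])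
    linarith
  have key := Complex.dist_le_div_mul_dist_of_mapsTo_ball hφ hφm hz
  rw [hφc, dist_zero_right, norm_div, div_le_iff₀ (norm_pos_iff.2 (hne z hz)),
    dist_eq_norm] at key
  calc _ ≤ _ := key
    _ = _ := by ring

/-- A holomorphic map of a disk to the unit disk approaches the unit circle at most linearly fast.
For the disk with centre `0` this bounds inner functions from the circle; for a disk internally
tangent to a larger domain it is the Hopf lemma at the point of tangency. -/
theorem one_sub_norm_ge {f : ℂ → ℂ} {c z : ℂ} {R : ℝ}
    (hd : DifferentiableOn ℂ f (Metric.ball c R))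
    (hm : MapsTo f (Metric.ball c R) (Metric.ball 0 1)) (hz : z ∈ Metric.ball c R) :
    (1 - ‖f c‖) / 4 * (1 - ‖z - c‖ / R) ≤ 1 - ‖f z‖ := by
  have hR : 0 < R := Metric.nonempty_ball.1 ⟨z, hz⟩
  have hn : ∀ w ∈ Metric.ball c R, ‖f w‖ < 1 := fun w hw => by simpa using hm hw
  have ha := hn c (Metric.mem_ball_self hR)
  have hb := hn z hz
  have key := schwarzPick hd hm hz
  have hid := sq_norm_one_sub_conj_mul_sub (f c) (f z)
  have ht0 : 0 ≤ ‖z - c‖ / R := by positivity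
  have ht1 : ‖z - c‖ / R < 1 := by
    rw [div_lt_one hR]; simpa [dist_eq_norm] using hz
  have hq : 1 - ‖f c‖ ≤ ‖1 - starRingEnd ℂ (f c) * f z‖ := by
    have h1 := norm_sub_norm_le (1 : ℂ) (starRingEnd ℂ (f c) * f z)
    rw [norm_mul, RCLike.norm_conj, norm_one] at h1
    nlinarith [norm_nonneg (f c), norm_nonneg (f z)]
  set t := ‖z - c‖ / R
  set q := ‖1 - starRingEnd ℂ (f c) * f z‖
  set a := ‖f c‖
  set b := ‖f z‖
  set p := ‖f z - f c‖
  have ha0 : 0 ≤ a := norm_nonneg _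
  have hb0 : 0 ≤ b := norm_nonneg _
  have hp0 : 0 ≤ p := norm_nonneg _
  have h1 : p ^ 2 ≤ q ^ 2 * t ^ 2 := by rw [← mul_pow]; gcongr
  have h2 : (1 - a) ^ 2 * (1 - t ^ 2) ≤ q ^ 2 * (1 - t ^ 2) := by
    have : 0 ≤ 1 - t ^ 2 := by nlinarith
    gcongr
  have h3 : (1 - a) ^ 2 * (1 - t ^ 2) ≤ (1 - a) * ((1 + a) * (1 - b ^ 2)) := by nlinarith
  have h4 : (1 - a) * (1 - t ^ 2) ≤ (1 + a) * (1 - b ^ 2) := by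
    have : 0 < 1 - a := by linarith
    refine le_of_mul_le_mul_left ?_ this
    linarith
  have h5 : (1 - a) * (1 - t) ≤ (1 - a) * (1 - t ^ 2) := by
    have : 0 ≤ 1 - a := by linarith
    gcongr; nlinarith
  have h6 : (1 + a) * (1 - b ^ 2) ≤ 2 * (1 - b ^ 2) := by
    have : 0 ≤ 1 - b ^ 2 := by nlinarith
    gcongr; linarith
  nlinarith

/-- The infinitesimal form of the Schwarz–Pick lemma. -/
theorem norm_deriv_le_of_mapsTo_unit_ball {f : ℂ → ℂ} {c : ℂ} {R : ℝ} (hR : 0 < R)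
    (hd : DifferentiableOn ℂ f (Metric.ball c R))
    (hm : MapsTo f (Metric.ball c R) (Metric.ball 0 1)) :
    ‖deriv f c‖ ≤ 2 * (1 - ‖f c‖) / R := by
  have hc : ‖f c‖ < 1 := by simpa using hm (Metric.mem_ball_self hR)
  have hdc : DifferentiableAt ℂ f c := hd.differentiableAt (Metric.ball_mem_nhds c hR)
  have h1 : Tendsto (fun z => ‖slope f c z‖) (𝓝[≠] c) (𝓝 ‖deriv f c‖) :=
    (hasDerivAt_iff_tendsto_slope.1 hdc.hasDerivAt).norm
  have h2 : Tendsto (fun z => ‖1 - starRingEnd ℂ (f c) * f z‖ / R) (𝓝[≠] c)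
      (𝓝 (‖1 - starRingEnd ℂ (f c) * f c‖ / R)) := by
    have : ContinuousAt (fun z => ‖1 - starRingEnd ℂ (f c) * f z‖ / R) c :=
      ((continuousAt_const.sub (continuousAt_const.mul hdc.continuousAt)).norm).div_const _
    exact this.tendsto.mono_left nhdsWithin_le_nhds
  have h3 : ‖deriv f c‖ ≤ ‖1 - starRingEnd ℂ (f c) * f c‖ / R := by
    refine le_of_tendsto_of_tendsto h1 h2 ?_
    filter_upwards [self_mem_nhdsWithin,
      mem_nhdsWithin_of_mem_nhds (Metric.ball_mem_nhds c hR)] with z hz hzb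
    have hzc : 0 < ‖z - c‖ := norm_pos_iff.2 (sub_ne_zero.2 hz)
    rw [slope_def_field, norm_div, div_le_iff₀ hzc]
    calc _ ≤ _ := schwarzPick hd hm hzb
      _ = _ := by ring
  refine h3.trans ?_
  gcongr
  rw [← Complex.normSq_eq_conj_mul_self, Complex.normSq_eq_norm_sq]
  have : (1 : ℂ) - ((‖f c‖ ^ 2 : ℝ) : ℂ) = ((1 - ‖f c‖ ^ 2 : ℝ) : ℂ) := by push_cast; ring
  rw [this, Complex.norm_real, Real.norm_of_nonneg (by nlinarith [norm_nonneg (f c)])]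
  nlinarith [norm_nonneg (f c)]

/-! ### Removability of a line -/

/-- A continuous function on a disk that is holomorphic off the real axis is holomorphic, by
Morera's theorem: a rectangle that meets the real axis is split along it. -/
theorem differentiableOn_ball_of_off_real {f : ℂ → ℂ} {c : ℂ} {s : ℝ}
    (hc : ContinuousOn f (Metric.ball c s))
    (hd : ∀ z ∈ Metric.ball c s, z.im ≠ 0 → DifferentiableAt ℂ f z) :
    DifferentiableOn ℂ f (Metric.ball c s) := by
  have base : ∀ z w : ℂ, Complex.Rectangle z w ⊆ Metric.ball c s →
      (0 ∉ Ioo (min z.im w.im) (max z.im w.im)) →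
      (∫ x : ℝ in z.re..w.re, f (x + z.im * Complex.I)) -
        (∫ x : ℝ in z.re..w.re, f (x + w.im * Complex.I)) +
        Complex.I • (∫ y : ℝ in z.im..w.im, f (w.re + y * Complex.I)) -
        Complex.I • (∫ y : ℝ in z.im..w.im, f (z.re + y * Complex.I)) = 0 := by
    intro z w hzw h0
    refine Complex.integral_boundary_rect_eq_zero_of_continuousOn_of_differentiableOn f z w
      (hc.mono hzw) ?_
    intro u hu
    rw [Complex.mem_reProdIm] at hu
    refine (hd u (hzw ?_) ?_).differentiableWithinAt
    · rw [Complex.Rectangle, Complex.mem_reProdIm, uIcc, uIcc]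
      exact ⟨Ioo_subset_Icc_self hu.1, Ioo_subset_Icc_self hu.2⟩
    · intro h; rw [h] at hu; exact h0 hu.2
  refine (Complex.isConservativeOn_and_continuousOn_iff_isDifferentiableOn Metric.isOpen_ball).1
    ⟨fun z w hzw => ?_, hc⟩
  rw [← add_eq_zero_iff_eq_neg, Complex.wedgeIntegral_add_wedgeIntegral_eq]
  by_cases h0 : 0 ∈ Ioo (min z.im w.im) (max z.im w.im)
  · have h0' : (0 : ℝ) ∈ uIcc z.im w.im := Ioo_subset_Icc_self h0
    have hu1 : uIcc z.im (0 : ℝ) ⊆ uIcc z.im w.im := uIcc_subset_uIcc_left h0'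
    have hu2 : uIcc (0 : ℝ) w.im ⊆ uIcc z.im w.im := uIcc_subset_uIcc_right h0'
    have hsub : ∀ u : ℂ, u.re ∈ uIcc z.re w.re → u.im ∈ uIcc z.im w.im → u ∈ Metric.ball c s :=
      fun u h1 h2 => hzw (by rw [Complex.Rectangle, Complex.mem_reProdIm]; exact ⟨h1, h2⟩)
    have e1 := base z ⟨w.re, 0⟩
      (fun u hu => by
        rw [Complex.Rectangle, Complex.mem_reProdIm] at hu
        exact hsub u hu.1 (hu1 hu.2))
      (fun h => by rcases le_total z.im 0 with h' | h' <;> simp [h'] at h)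
    have e2 := base ⟨z.re, 0⟩ w
      (fun u hu => by
        rw [Complex.Rectangle, Complex.mem_reProdIm] at hu
        exact hsub u hu.1 (hu2 hu.2))
      (fun h => by rcases le_total w.im 0 with h' | h' <;> simp [h'] at h)
    have hint : ∀ x ∈ uIcc z.re w.re, ∀ a b : ℝ, uIcc a b ⊆ uIcc z.im w.im →
        IntervalIntegrable (fun y : ℝ => f (x + y * Complex.I)) MeasureTheory.volume a b := by
      intro x hx a b hab
      refine ContinuousOn.intervalIntegrable ?_
      refine hc.comp (by fun_prop) fun y hy => hsub _ (by simpa using hx) (by simpa using hab hy)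
    have a1 := intervalIntegral.integral_add_adjacent_intervals
      (hint w.re right_mem_uIcc _ _ hu1) (hint w.re right_mem_uIcc _ _ hu2)
    have a2 := intervalIntegral.integral_add_adjacent_intervals
      (hint z.re left_mem_uIcc _ _ hu1) (hint z.re left_mem_uIcc _ _ hu2)
    rw [← a1, ← a2]
    simp only [smul_eq_mul] at e1 e2 ⊢
    linear_combination e1 + e2
  · exact base z w hzw h0

/-! ### Lifting through sections -/

/-- Two sections over a preconnected set which agree at one point agree everywhere, if the image
of one of them is open. -/
theorem eqOn_of_section {E X : Type*} [TopologicalSpace E] [TopologicalSpace X] [T2Space E]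
    {p : E → X} {V : Set X} (hV : IsOpen V) (hVc : IsPreconnected V) {k₁ k₂ : X → E}
    (h1 : ContinuousOn k₁ V) (h2 : ContinuousOn k₂ V) (hp1 : ∀ w ∈ V, p (k₁ w) = w)
    (hp2 : ∀ w ∈ V, p (k₂ w) = w) (ho : IsOpen (k₁ '' V)) {w₀ : X} (hw₀ : w₀ ∈ V)
    (he : k₁ w₀ = k₂ w₀) : EqOn k₁ k₂ V := by
  have hA : IsOpen (V ∩ k₂ ⁻¹' (k₁ '' V)) := h2.isOpen_inter_preimage hV ho
  have hAeq : V ∩ k₂ ⁻¹' (k₁ '' V) = {w ∈ V | k₁ w = k₂ w} := by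
    ext w
    constructor
    · rintro ⟨hw, w', hw', e⟩
      have : w' = w := by rw [← hp1 w' hw', e, hp2 w hw]
      exact ⟨hw, this ▸ e⟩
    · rintro ⟨hw, e⟩
      exact ⟨hw, w, hw, e⟩
  have hB : IsOpen (V ∩ (fun w => (k₁ w, k₂ w)) ⁻¹' (diagonal E)ᶜ) :=
    (h1.prodMk h2).isOpen_inter_preimage hV isClosed_diagonal.isOpen_compl
  by_contra hne
  obtain ⟨w, hw, hwne⟩ : ∃ w ∈ V, k₁ w ≠ k₂ w := by simpa [EqOn] using hne
  obtain ⟨u, hu, hu1, hu2⟩ := hVc _ _ hA hB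
    (fun u hu => by
      by_cases e : k₁ u = k₂ u
      · exact Or.inl (by rw [hAeq]; exact ⟨hu, e⟩)
      · exact Or.inr ⟨hu, e⟩)
    ⟨w₀, hw₀, by rw [hAeq]; exact ⟨hw₀, he⟩⟩ ⟨w, hw, hw, hwne⟩
  rw [hAeq] at hu1
  exact hu2.2 hu1.2

/-- A map is a covering over `W` if near every point of `W` it has an open section
through every point above. -/
theorem isCoveringMapOn_of_sections {E X : Type*} [TopologicalSpace E] [TopologicalSpace X]
    [T2Space E] {p : E → X} {W : Set X}
    (h : ∀ v ∈ W, ∃ V : Set X, IsOpen V ∧ IsPreconnected V ∧ v ∈ V ∧ ∀ e, p e ∈ V →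
      ∃ k : X → E, ContinuousOn k V ∧ (∀ w ∈ V, p (k w) = w) ∧ k (p e) = e ∧
        ∀ O ⊆ V, IsOpen O → IsOpen (k '' O)) : IsCoveringMapOn p W := by
  intro v hv
  obtain ⟨V, hVo, hVc, hvV, hk⟩ := h v hv
  by_cases hne : (p ⁻¹' V) = ∅
  · have : IsEmpty (p ⁻¹' {v}) := by
      refine isEmpty_coe_sort.2 (eq_empty_of_subset_empty fun e he => ?_)
      have h1 : e ∈ p ⁻¹' V := by
        rw [mem_preimage, (he : p e = v)]; exact hvV
      rwa [hne] at h1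
    exact .of_preimage_eq_empty _ (hVo.mem_nhds hvV) hne
  obtain ⟨e₀, he₀⟩ := nonempty_iff_ne_empty.2 hne
  have : Nonempty E := ⟨e₀⟩
  choose! k kc kp ke ko using hk
  have hmem : ∀ i : p ⁻¹' {v}, p i ∈ V := fun i => by rw [(i.2 : p i = v)]; exact hvV
  have kv : ∀ i : p ⁻¹' {v}, k i v = i := fun i => by
    have := ke i (hmem i); rwa [(i.2 : p i = v)] at this
  have hpre : ∀ i : p ⁻¹' {v}, ∀ O ⊆ V, p ⁻¹' O ∩ k i '' V = k i '' O := by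
    intro i O hO
    ext e
    constructor
    · rintro ⟨he, w, hw, rfl⟩
      rw [mem_preimage, kp i (hmem i) w hw] at he
      exact ⟨w, he, rfl⟩
    · rintro ⟨w, hw, rfl⟩
      exact ⟨by rw [mem_preimage, kp i (hmem i) w (hO hw)]; exact hw, w, hO hw, rfl⟩
  have hn2 : Nonempty (p ⁻¹' {v}) := ⟨⟨k e₀ v, kp e₀ he₀ v hvV⟩⟩
  have hn1 : Nonempty (X → E) := ⟨k e₀⟩
  have hdisc : DiscreteTopology (p ⁻¹' {v}) := by
    refine discreteTopology_iff_isOpen_singleton.2 fun i => ?_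
    have : ({i} : Set (p ⁻¹' {v})) = Subtype.val ⁻¹' (k i '' V) := by
      ext j
      constructor
      · rintro rfl
        exact ⟨v, hvV, kv j⟩
      · rintro ⟨w, hw, e⟩
        have h1 : w = v := by
          rw [← kp i (hmem i) w hw, e]; exact j.2
        rw [h1, kv i] at e
        exact Subtype.ext e.symm
    rw [this]
    exact (ko i (hmem i) V subset_rfl hVo).preimage continuous_subtype_val
  refine IsEvenlyCovered.of_trivialization
    (t := hVo.trivializationDiscrete (fun i : p ⁻¹' {v} => k i '' V) V
      (fun i O hO => ?_) (fun i => ?_) (fun i => ?_) ?_ ?_) hvV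
  · rw [hpre i O hO]
    refine ⟨ko i (hmem i) O hO, fun ho => ?_⟩
    have h1 := (kc i (hmem i)).isOpen_inter_preimage hVo ho
    convert h1 using 1
    ext w
    constructor
    · exact fun hw => ⟨hO hw, w, hw, rfl⟩
    · rintro ⟨hw, w', hw', e⟩
      have : w' = w := by
        rw [← kp i (hmem i) w' (hO hw'), e, kp i (hmem i) w hw]
      exact this ▸ hw'
  · rintro _ ⟨w, hw, rfl⟩ _ ⟨w', hw', rfl⟩ e
    rw [kp i (hmem i) w hw, kp i (hmem i) w' hw'] at e
    rw [e]
  · exact fun w hw => ⟨k i w, ⟨w, hw, rfl⟩, kp i (hmem i) w hw⟩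
  · intro i j hij
    refine disjoint_left.2 ?_
    rintro _ ⟨w, hw, rfl⟩ ⟨w', hw', e⟩
    have hww : w' = w := by
      rw [← kp j (hmem j) w' hw', e, kp i (hmem i) w hw]
    subst hww
    have := eqOn_of_section hVo hVc (kc i (hmem i)) (kc j (hmem j)) (kp i (hmem i))
      (kp j (hmem j)) (ko i (hmem i) V subset_rfl hVo) hw e.symm hvV
    rw [kv i, kv j] at this
    exact hij (Subtype.ext this)
  · intro e he
    refine mem_iUnion.2 ⟨⟨k e v, kp e he v hvV⟩, p e, he, ?_⟩
    set i : p ⁻¹' {v} := ⟨k e v, kp e he v hvV⟩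
    have := eqOn_of_section hVo hVc (kc i (hmem i)) (kc e he) (kp i (hmem i))
      (kp e he) (ko i (hmem i) V subset_rfl hVo) hvV (kv i) he
    rw [this, ke e he]

/-- **Monodromy.** If every point of a convex open set `W` has a disk on which all local inverses of
a holomorphic map `g` of the unit disk are defined, then all local inverses of `g` extend
holomorphically to `W`. -/
theorem exists_inverse_on_convex {g : ℂ → ℂ} (hg : DifferentiableOn ℂ g (Metric.ball 0 1))
    {W : Set ℂ} (hWo : IsOpen W) (hW : Convex ℝ W)
    (h : ∀ v ∈ W, ∃ r > 0, ∀ z ∈ Metric.ball (0 : ℂ) 1, g z ∈ Metric.ball v r →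
      ∃ k : ℂ → ℂ, DifferentiableOn ℂ k (Metric.ball v r) ∧
        MapsTo k (Metric.ball v r) (Metric.ball 0 1) ∧
        (∀ w ∈ Metric.ball v r, g (k w) = w) ∧ k (g z) = z)
    {z₀ : ℂ} (hz₀ : z₀ ∈ Metric.ball (0 : ℂ) 1) (hgz₀ : g z₀ ∈ W) :
    ∃ k : ℂ → ℂ, DifferentiableOn ℂ k W ∧ MapsTo k W (Metric.ball 0 1) ∧
      (∀ w ∈ W, g (k w) = w) ∧ k (g z₀) = z₀ := by
  let p : Metric.ball (0 : ℂ) 1 → ℂ := fun z => g z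
  have hcov : IsCoveringMapOn p W := by
    refine isCoveringMapOn_of_sections fun v hv => ?_
    obtain ⟨r, hr, hk⟩ := h v hv
    refine ⟨Metric.ball v r, Metric.isOpen_ball, (convex_ball v r).isPreconnected,
      Metric.mem_ball_self hr, fun e he => ?_⟩
    obtain ⟨k, kd, km, kp, ke⟩ := hk e e.2 he
    classical
    let k' : ℂ → Metric.ball (0 : ℂ) 1 := fun w =>
      if hw : w ∈ Metric.ball v r then ⟨k w, km hw⟩ else e
    have hk' : ∀ w ∈ Metric.ball v r, (k' w : ℂ) = k w := fun w hw => by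
      simp only [k', dif_pos hw]
    refine ⟨k', ?_, fun w hw => ?_, ?_, fun O hO hOo => ?_⟩
    · rw [IsInducing.subtypeVal.continuousOn_iff]
      exact kd.continuousOn.congr hk'
    · change g (k' w) = w
      rw [hk' w hw, kp w hw]
    · refine Subtype.ext ?_
      rw [hk' _ he, ke]
    · have hinj : InjOn k (Metric.ball v r) := fun a ha b hb e => by
        rw [← kp a ha, e, kp b hb]
      have hko : IsOpen (k '' O) := by
        rcases (kd.analyticOnNhd Metric.isOpen_ball).is_constant_or_isOpen
          (convex_ball v r).isPreconnected with ⟨w, hw⟩ | ho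
        · exfalso
          have hx : v + ((r / 2 : ℝ) : ℂ) ∈ Metric.ball v r := by
            simp [abs_of_pos hr]; linarith
          have := hinj (Metric.mem_ball_self hr) hx
            ((hw _ (Metric.mem_ball_self hr)).trans (hw _ hx).symm)
          simp [hr.ne'] at this
        · exact ho O hO hOo
      convert hko.preimage (continuous_subtype_val (p := (· ∈ Metric.ball (0 : ℂ) 1))) using 1
      ext x
      constructor
      · rintro ⟨w, hw, rfl⟩
        exact ⟨w, hw, (hk' w (hO hw)).symm⟩
      · rintro ⟨w, hw, e⟩
        exact ⟨w, hw, Subtype.ext ((hk' w (hO hw)).trans e)⟩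
  have : ContractibleSpace W := hW.contractibleSpace ⟨_, hgz₀⟩
  have : LocallyPathConnectedSpace W := hWo.locallyPathConnectedSpace
  obtain ⟨F, ⟨hF0, hF⟩, -⟩ := hcov.existsUnique_continuousMap_lifts
    (A := W) ⟨Subtype.val, continuous_subtype_val⟩ (a₀ := ⟨g z₀, hgz₀⟩) (e₀ := ⟨z₀, hz₀⟩) rfl
    (fun a => a.2)
  classical
  let k : ℂ → ℂ := fun w => if hw : w ∈ W then F ⟨w, hw⟩ else 0
  have hk : ∀ w (hw : w ∈ W), k w = F ⟨w, hw⟩ := fun w hw => by simp only [k, dif_pos hw]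
  have kp : ∀ w ∈ W, g (k w) = w := fun w hw => by
    rw [hk w hw]; exact congrFun hF ⟨w, hw⟩
  have km : MapsTo k W (Metric.ball 0 1) := fun w hw => by
    rw [hk w hw]; exact (F ⟨w, hw⟩).2
  have kc : ContinuousOn k W := by
    rw [continuousOn_iff_continuous_domRestrict]
    have : W.domRestrict k = fun w => (F w : ℂ) := by
      ext w; exact hk w w.2
    rw [this]
    fun_prop
  refine ⟨k, fun w hw => ?_, km, kp, by rw [hk _ hgz₀, hF0]⟩
  have hgd : DifferentiableAt ℂ g (k w) :=
    hg.differentiableAt (Metric.isOpen_ball.mem_nhds (km hw))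
  have hne : deriv g (k w) ≠ 0 := by
    obtain ⟨r, hr, hloc⟩ := h w hw
    obtain ⟨l, ld, -, lp, le⟩ := hloc (k w) (km hw) (by rw [kp w hw]; exact Metric.mem_ball_self hr)
    rw [kp w hw] at le
    have h1 : HasDerivAt l (deriv l w) w :=
      (ld.differentiableAt (Metric.ball_mem_nhds w hr)).hasDerivAt
    have h2 : HasDerivAt g (deriv g (k w)) (l w) := by rw [le]; exact hgd.hasDerivAt
    have h3 := (h2.comp w h1).unique ((hasDerivAt_id w).congr_of_eventuallyEq
      (by filter_upwards [Metric.ball_mem_nhds w hr] with u hu using lp u hu))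
    intro h0
    rw [h0, zero_mul] at h3
    exact zero_ne_one h3
  exact (HasDerivAt.of_local_left_inverse (kc.continuousAt (hWo.mem_nhds hw)) hgd.hasDerivAt hne
    (by filter_upwards [hWo.mem_nhds hw] with u hu using kp u hu)).differentiableAt
      |>.differentiableWithinAt

/-! ### Reflection in the unit circle -/

theorem norm_conj_inv (w : ℂ) : ‖(starRingEnd ℂ w)⁻¹‖ = ‖w‖⁻¹ := by
  rw [norm_inv, RCLike.norm_conj]

theorem conj_inv_eq_self {w : ℂ} (hw : ‖w‖ = 1) : (starRingEnd ℂ w)⁻¹ = w := by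
  rw [Complex.inv_def, Complex.conj_conj, Complex.normSq_conj, Complex.normSq_eq_norm_sq, hw]
  simp

theorem conj_inv_conj_inv (w : ℂ) : (starRingEnd ℂ (starRingEnd ℂ w)⁻¹)⁻¹ = w := by
  simp

/-- Reflection maps the outer part of a disk centred on the unit circle into the disk. -/
theorem conj_inv_mem_ball {ξ w : ℂ} {ρ : ℝ} (hξ : ‖ξ‖ = 1) (hw : w ∈ Metric.ball ξ ρ)
    (h1 : 1 ≤ ‖w‖) : (starRingEnd ℂ w)⁻¹ ∈ Metric.ball ξ ρ := by
  rw [mem_ball_iff_norm] at hw ⊢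
  have hw0 : starRingEnd ℂ w ≠ 0 := by
    intro h
    have : ‖starRingEnd ℂ w‖ = 0 := by rw [h, norm_zero]
    rw [RCLike.norm_conj] at this
    linarith
  have hξ0 : starRingEnd ℂ ξ ≠ 0 := by
    intro h
    have : ‖starRingEnd ℂ ξ‖ = 0 := by rw [h, norm_zero]
    rw [RCLike.norm_conj] at this
    linarith
  have e : (starRingEnd ℂ w)⁻¹ - ξ =
      starRingEnd ℂ (ξ - w) / (starRingEnd ℂ w * starRingEnd ℂ ξ) := by
    nth_rewrite 1 [← conj_inv_eq_self hξ]
    rw [map_sub]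
    field_simp
  rw [e, norm_div, norm_mul, RCLike.norm_conj, RCLike.norm_conj, RCLike.norm_conj, hξ, mul_one,
    norm_sub_rev]
  exact (div_le_self (norm_nonneg _) h1).trans_lt hw

/-- The **Schwarz reflection principle** for a map `G` to the unit disk, defined on the part of the
unit disk close to a boundary point `ξ`, with `1 - ‖G w‖` at most proportional to `1 - ‖w‖`.
This quantitative form of `‖G‖ → 1` makes `G` Lipschitz, by the Schwarz–Pick lemma, hence
continuous up to the circle, and it keeps the zeros of `G` at a distance from `ξ` which does not
depend on `G`. -/
theorem exists_reflection {G : ℂ → ℂ} {ξ : ℂ} {ρ κ : ℝ} (hξ : ‖ξ‖ = 1) (hκ : 0 < κ) (hρκ : ρ ≤ κ)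
    (hd : DifferentiableOn ℂ G (Metric.ball ξ (2 * ρ) ∩ Metric.ball 0 1))
    (hm : MapsTo G (Metric.ball ξ (2 * ρ) ∩ Metric.ball 0 1) (Metric.ball 0 1))
    (hG : ∀ w ∈ Metric.ball ξ (2 * ρ) ∩ Metric.ball 0 1, κ * (1 - ‖G w‖) ≤ 1 - ‖w‖) :
    ∃ T : ℂ → ℂ, DifferentiableOn ℂ T (Metric.ball ξ ρ) ∧
      (∀ w ∈ Metric.ball ξ ρ, ‖w‖ < 1 → T w = G w) ∧
      (∀ w ∈ Metric.ball ξ ρ, ‖w‖ = 1 → ‖T w‖ = 1) ∧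
      ∀ w ∈ Metric.ball ξ ρ, 1 < ‖w‖ →
        1 < ‖T w‖ ∧ T w = (starRingEnd ℂ (G (starRingEnd ℂ w)⁻¹))⁻¹ := by
  set A := Metric.ball ξ ρ with hA
  set B := A ∩ Metric.ball 0 1 with hB
  have hAlt : ∀ w ∈ A, 1 - ‖w‖ < ρ := fun w hw => by
    have h1 := norm_sub_norm_le ξ w
    have h2 := mem_ball_iff_norm'.1 hw
    linarith
  have hBsub : B ⊆ Metric.ball ξ (2 * ρ) ∩ Metric.ball 0 1 := by
    rintro w ⟨hw, hw1⟩
    exact ⟨Metric.ball_subset_ball (by linarith [Metric.pos_of_mem_ball hw]) hw, hw1⟩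
  have hBo : IsOpen B := Metric.isOpen_ball.inter Metric.isOpen_ball
  have hdB : ∀ w ∈ B, DifferentiableAt ℂ G w := fun w hw =>
    hd.differentiableAt ((Metric.isOpen_ball.inter Metric.isOpen_ball).mem_nhds (hBsub hw))
  have hlip : LipschitzOnWith (Real.toNNReal (2 / κ)) G B := by
    refine Convex.lipschitzOnWith_of_nnnorm_deriv_le hdB (fun w hw => ?_)
      ((convex_ball _ _).inter (convex_ball _ _))
    rw [← NNReal.coe_le_coe, coe_nnnorm, Real.coe_toNNReal _ (by positivity)]
    have hw1 : ‖w‖ < 1 := by simpa using hw.2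
    have hR : 0 < 1 - ‖w‖ := by linarith
    have hsub : Metric.ball w (1 - ‖w‖) ⊆ Metric.ball ξ (2 * ρ) ∩ Metric.ball 0 1 := by
      refine subset_inter (Metric.ball_subset_ball' ?_) (Metric.ball_subset_ball' ?_)
      · have := hAlt w hw.1
        have := Metric.mem_ball.1 hw.1
        linarith
      · rw [dist_zero_right]; linarith
    refine (norm_deriv_le_of_mapsTo_unit_ball hR (hd.mono hsub) (hm.mono_left hsub)).trans ?_
    rw [div_le_div_iff₀ hR hκ]
    have := hG w (hBsub hw)
    nlinarith
  obtain ⟨T₁, hT₁lip, hT₁⟩ := hlip.extend_finite_dimension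
  have hT₁c : Continuous T₁ := hT₁lip.continuous
  have hcl : ∀ w ∈ A, ‖w‖ ≤ 1 → κ * (1 - ‖T₁ w‖) ≤ 1 - ‖w‖ ∧ ‖T₁ w‖ ≤ 1 := by
    intro w hw hw1
    have hS : IsClosed ({w | κ * (1 - ‖T₁ w‖) ≤ 1 - ‖w‖} ∩ {w | ‖T₁ w‖ ≤ 1}) :=
      (isClosed_le (by fun_prop) (by fun_prop)).inter (isClosed_le (by fun_prop) (by fun_prop))
    have hBS : B ⊆ {w | κ * (1 - ‖T₁ w‖) ≤ 1 - ‖w‖} ∩ {w | ‖T₁ w‖ ≤ 1} := by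
      intro u hu
      have h1 := hG u (hBsub hu)
      have h2 := (mem_ball_zero_iff.1 (hm (hBsub hu))).le
      rw [hT₁ hu] at h1 h2
      exact ⟨h1, h2⟩
    refine closure_minimal hBS hS (Metric.isOpen_ball.inter_closure ⟨hw, ?_⟩)
    rw [closure_ball _ one_ne_zero]
    simpa using hw1
  have hne : ∀ w ∈ A, ‖w‖ ≤ 1 → T₁ w ≠ 0 := by
    intro w hw hw1 h0
    have h1 := (hcl w hw hw1).1
    rw [h0, norm_zero] at h1
    linarith [hAlt w hw]
  have hcirc : ∀ w ∈ A, ‖w‖ = 1 → ‖T₁ w‖ = 1 := by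
    intro w hw hw1
    have h1 := hcl w hw hw1.le
    rw [hw1] at h1
    refine le_antisymm h1.2 ?_
    nlinarith [h1.1]
  have hrefl : ∀ w ∈ A, 1 ≤ ‖w‖ → (starRingEnd ℂ w)⁻¹ ∈ A ∧ ‖(starRingEnd ℂ w)⁻¹‖ ≤ 1 :=
    fun w hw h1 => ⟨conj_inv_mem_ball hξ hw h1, by
      rw [norm_conj_inv]; exact inv_le_one_of_one_le₀ h1⟩
  classical
  let T₂ : ℂ → ℂ := fun w => (starRingEnd ℂ (T₁ (starRingEnd ℂ w)⁻¹))⁻¹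
  let T : ℂ → ℂ := fun w => if ‖w‖ ≤ 1 then T₁ w else T₂ w
  have hTin : ∀ w, ‖w‖ ≤ 1 → T w = T₁ w := fun w hw => if_pos hw
  have hTout : ∀ w, 1 < ‖w‖ → T w = T₂ w := fun w hw => if_neg (not_le.2 hw)
  have hTc : ContinuousOn T A := by
    refine ContinuousOn.if ?_ hT₁c.continuousOn ?_
    · rintro w ⟨hw, hf⟩
      have hw1 : ‖w‖ = 1 := frontier_le_subset_eq continuous_norm continuous_const hf
      change T₁ w = (starRingEnd ℂ (T₁ (starRingEnd ℂ w)⁻¹))⁻¹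
      rw [conj_inv_eq_self hw1, conj_inv_eq_self (hcirc w hw hw1)]
    · rintro w ⟨hw, hf⟩
      have hw1 : 1 ≤ ‖w‖ := by
        have : closure {a : ℂ | ¬ ‖a‖ ≤ 1} ⊆ {a | 1 ≤ ‖a‖} :=
          closure_minimal (fun a ha => (not_le.1 ha).le)
            (isClosed_le continuous_const continuous_norm)
        exact this hf
      have hw0 : starRingEnd ℂ w ≠ 0 := by
        rw [Ne, map_eq_zero, ← norm_eq_zero]; linarith
      obtain ⟨h1, h2⟩ := hrefl w hw hw1
      refine ContinuousAt.continuousWithinAt ?_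
      refine ContinuousAt.inv₀ ?_ ((map_ne_zero _).2 (hne _ h1 h2))
      refine Complex.continuous_conj.continuousAt.comp (hT₁c.continuousAt.comp ?_)
      exact Complex.continuous_conj.continuousAt.inv₀ hw0
  have hT₁d : ∀ w ∈ A, ‖w‖ < 1 → DifferentiableAt ℂ T₁ w := by
    intro w hw hw1
    have hwB : w ∈ B := ⟨hw, by simpa using hw1⟩
    refine (hdB w hwB).congr_of_eventuallyEq ?_
    filter_upwards [hBo.mem_nhds hwB] with u hu using (hT₁ hu).symm
  have hTd : ∀ w ∈ A, ‖w‖ ≠ 1 → DifferentiableAt ℂ T w := by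
    intro w hw hw1
    rcases lt_or_gt_of_ne hw1 with h | h
    · refine (hT₁d w hw h).congr_of_eventuallyEq ?_
      filter_upwards [continuous_norm.continuousAt.eventually (gt_mem_nhds h)] with u hu
        using hTin u hu.le
    · have hw0 : w ≠ 0 := by rw [← norm_ne_zero_iff]; linarith
      have hmem : (starRingEnd ℂ w)⁻¹ ∈ A := conj_inv_mem_ball hξ hw h.le
      have hlt : ‖(starRingEnd ℂ w)⁻¹‖ < 1 := by
        rw [norm_conj_inv]; exact inv_lt_one_of_one_lt₀ h
      have h1 := (hT₁d _ hmem hlt).star_star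
      have e : star ((starRingEnd ℂ w)⁻¹) = w⁻¹ := by
        rw [← starRingEnd_apply, map_inv₀, Complex.conj_conj]
      rw [e] at h1
      have h2 : DifferentiableAt ℂ (fun u : ℂ => ((star ∘ T₁ ∘ star) u⁻¹)⁻¹) w := by
        refine DifferentiableAt.inv (h1.comp w (differentiableAt_inv hw0)) ?_
        have := hne _ hmem hlt.le
        simpa using this
      refine h2.congr_of_eventuallyEq ?_
      filter_upwards [continuous_norm.continuousAt.eventually (lt_mem_nhds h)] with u hu
      rw [hTout u hu]
      simp [T₂]
  have hTd1 : ∀ w ∈ A, ‖w‖ = 1 → DifferentiableAt ℂ T w := by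
    intro w hw hw1
    have hw0 : w ≠ 0 := by rw [← norm_ne_zero_iff]; linarith
    -- The chart `t ↦ w exp (i t)` straightens the unit circle near `w`.
    let φ : ℂ → ℂ := fun t => w * Complex.exp (Complex.I * t)
    have hφd : Differentiable ℂ φ := by fun_prop
    have hφ0 : φ 0 = w := by simp [φ]
    obtain ⟨s, hs, hsA⟩ := Metric.mem_nhds_iff.1
      (hφd.continuous.continuousAt.preimage_mem_nhds
        (show A ∈ 𝓝 (φ 0) by rw [hφ0]; exact Metric.isOpen_ball.mem_nhds hw))
    have hK : DifferentiableOn ℂ (T ∘ φ) (Metric.ball 0 s) := by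
      refine differentiableOn_ball_of_off_real (hTc.comp hφd.continuous.continuousOn hsA) ?_
      intro t ht ht0
      refine (hTd _ (hsA ht) ?_).comp t (hφd t)
      rw [norm_mul, hw1, one_mul, Complex.norm_exp]
      simpa using ht0
    have hK0 : DifferentiableAt ℂ (T ∘ φ) 0 := hK.differentiableAt (Metric.ball_mem_nhds 0 hs)
    let ψ : ℂ → ℂ := fun u => -Complex.I * Complex.log (u / w)
    have hψ0 : ψ w = 0 := by simp [ψ, hw0]
    have hψd : DifferentiableAt ℂ ψ w := by
      refine DifferentiableAt.const_mul ?_ _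
      exact (differentiableAt_id.div_const w).clog (by simp [hw0])
    have h1 : DifferentiableAt ℂ ((T ∘ φ) ∘ ψ) w :=
      DifferentiableAt.comp w (by rw [hψ0]; exact hK0) hψd
    refine h1.congr_of_eventuallyEq ?_
    filter_upwards [isOpen_ne.mem_nhds hw0] with u hu
    have : φ (ψ u) = u := by
      have e : Complex.I * (-Complex.I * Complex.log (u / w)) = Complex.log (u / w) := by
        rw [← mul_assoc, mul_neg, Complex.I_mul_I]; ring
      simp only [φ, ψ]
      rw [e, Complex.exp_log (div_ne_zero hu hw0)]
      field_simp
    simp only [Function.comp_apply, this]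
  refine ⟨T, fun w hw => ?_, fun w hw hw1 => ?_, fun w hw hw1 => ?_, fun w hw hw1 => ?_⟩
  · by_cases h : ‖w‖ = 1
    · exact (hTd1 w hw h).differentiableWithinAt
    · exact (hTd w hw h).differentiableWithinAt
  · rw [hTin w hw1.le]
    exact (hT₁ ⟨hw, by simpa using hw1⟩).symm
  · rw [hTin w hw1.le, hcirc w hw hw1]
  · have hmem : (starRingEnd ℂ w)⁻¹ ∈ A := conj_inv_mem_ball hξ hw hw1.le
    have hlt : ‖(starRingEnd ℂ w)⁻¹‖ < 1 := by
      rw [norm_conj_inv]; exact inv_lt_one_of_one_lt₀ hw1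
    have hmB : (starRingEnd ℂ w)⁻¹ ∈ B := ⟨hmem, by simpa using hlt⟩
    have e := hT₁ hmB
    rw [hTout w hw1]
    simp only [T₂]
    refine ⟨?_, by rw [e]⟩
    rw [norm_conj_inv]
    refine (one_lt_inv₀ (norm_pos_iff.2 (hne _ hmem hlt.le))).2 ?_
    rw [← e]
    exact mem_ball_zero_iff.1 (hm (hBsub hmB))

/-- A holomorphic map which preserves the unit disk and the unit circle near a point of the circle
is locally invertible there, by the Hopf lemma. -/
theorem deriv_ne_zero_of_norm_eq_one {T : ℂ → ℂ} {ζ : ℂ} (hζ : ‖ζ‖ = 1)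
    (hd : DifferentiableAt ℂ T ζ) (hT1 : ‖T ζ‖ = 1)
    (hT : ∀ᶠ w in 𝓝 ζ, ‖w‖ < 1 → DifferentiableAt ℂ T w ∧ ‖T w‖ < 1) : deriv T ζ ≠ 0 := by
  intro h0
  obtain ⟨ρ, hρ, hρT⟩ := Metric.eventually_nhds_iff_ball.1 hT
  -- The disk with centre `(1 - t) ζ` and radius `t` is internally tangent to the circle at `ζ`.
  obtain ⟨t, ht0, ht1, htρ⟩ : ∃ t : ℝ, 0 < t ∧ t < 1 ∧ 2 * t < ρ := by
    refine ⟨min (1 / 2) (ρ / 4), by positivity, ?_, ?_⟩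
    · exact (min_le_left _ _).trans_lt (by norm_num)
    · linarith [min_le_right (1 / 2 : ℝ) (ρ / 4)]
  set c : ℂ := ((1 - t : ℝ) : ℂ) * ζ with hc
  have hcn : ‖c‖ = 1 - t := by
    rw [hc, norm_mul, hζ, mul_one, Complex.norm_real, Real.norm_of_nonneg (by linarith)]
  have hcζ : dist c ζ = t := by
    have : c - ζ = ((-t : ℝ) : ℂ) * ζ := by rw [hc]; push_cast; ring
    rw [dist_eq_norm, this, norm_mul, hζ, mul_one, Complex.norm_real, Real.norm_eq_abs, abs_neg,
      abs_of_pos ht0]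
  have hball : ∀ w ∈ Metric.ball c t, DifferentiableAt ℂ T w ∧ ‖T w‖ < 1 := by
    intro w hw
    refine hρT w ?_ ?_
    · exact Metric.ball_subset_ball' (by rw [hcζ]; linarith) hw
    · have := norm_sub_norm_le w c
      have := mem_ball_iff_norm.1 hw
      linarith
  have hTc : ‖T c‖ < 1 := (hball c (Metric.mem_ball_self ht0)).2
  set m := (1 - ‖T c‖) / 4 / t with hm
  have hm0 : 0 < m := by
    have : 0 < 1 - ‖T c‖ := by linarith
    positivity
  have hlow : ∀ τ : ℝ, 0 < τ → τ < t → m * τ ≤ 1 - ‖T (((1 - τ : ℝ) : ℂ) * ζ)‖ := by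
    intro τ h1 h2
    have hd : ‖((1 - τ : ℝ) : ℂ) * ζ - c‖ = t - τ := by
      have : ((1 - τ : ℝ) : ℂ) * ζ - c = ((t - τ : ℝ) : ℂ) * ζ := by rw [hc]; push_cast; ring
      rw [this, norm_mul, hζ, mul_one, Complex.norm_real, Real.norm_of_nonneg (by linarith)]
    have := one_sub_norm_ge (f := T) (c := c) (R := t) (z := ((1 - τ : ℝ) : ℂ) * ζ)
      (fun w hw => (hball w hw).1.differentiableWithinAt)
      (fun w hw => by simpa using (hball w hw).2) (by rw [mem_ball_iff_norm, hd]; linarith)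
    rw [hd] at this
    calc m * τ = (1 - ‖T c‖) / 4 * (1 - (t - τ) / t) := by rw [hm]; field_simp; ring
      _ ≤ _ := this
  have hder := hd.hasDerivAt
  rw [h0, hasDerivAt_iff_isLittleO] at hder
  have hev := hder.def (half_pos hm0)
  have htend : Tendsto (fun τ : ℝ => ((1 - τ : ℝ) : ℂ) * ζ) (𝓝[>] 0) (𝓝 ζ) := by
    have : Continuous fun τ : ℝ => ((1 - τ : ℝ) : ℂ) * ζ := by fun_prop
    have h := this.tendsto 0
    simp only [sub_zero, Complex.ofReal_one, one_mul] at h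
    exact h.mono_left nhdsWithin_le_nhds
  obtain ⟨τ, hτ, hτ0, hτt⟩ := ((htend.eventually hev).and
    (Ioo_mem_nhdsGT ht0)).exists
  have h1 := hlow τ hτ0 hτt
  have h2 : ‖((1 - τ : ℝ) : ℂ) * ζ - ζ‖ = τ := by
    have : ((1 - τ : ℝ) : ℂ) * ζ - ζ = ((-τ : ℝ) : ℂ) * ζ := by push_cast; ring
    rw [this, norm_mul, hζ, mul_one, Complex.norm_real, Real.norm_eq_abs, abs_neg, abs_of_pos hτ0]
  rw [smul_zero, sub_zero, h2] at hτ
  have h3 := norm_sub_norm_le (T ζ) (T (((1 - τ : ℝ) : ℂ) * ζ))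
  rw [norm_sub_rev, hT1] at h3
  nlinarith

/-- A holomorphic right inverse `T` of `g` which preserves the two sides of the unit circle near a
point `ζ` of the circle continues `g` analytically at `T ζ`. -/
theorem exists_analytic_continuation {g T : ℂ → ℂ} {ζ : ℂ} (hζ : ‖ζ‖ = 1)
    (hd : AnalyticAt ℂ T ζ) (hT1 : ‖T ζ‖ = 1)
    (hin : ∀ᶠ w in 𝓝 ζ, ‖w‖ < 1 → ‖T w‖ < 1 ∧ g (T w) = w)
    (hout : ∀ᶠ w in 𝓝 ζ, 1 ≤ ‖w‖ → 1 ≤ ‖T w‖) :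
    ∃ h : ℂ → ℂ, AnalyticAt ℂ h (T ζ) ∧ h (T ζ) = ζ ∧ h =ᶠ[𝓝[Metric.ball 0 1] (T ζ)] g := by
  have hne : deriv T ζ ≠ 0 := by
    refine deriv_ne_zero_of_norm_eq_one hζ hd.differentiableAt hT1 ?_
    filter_upwards [hin, hd.eventually_analyticAt] with w h1 h2 h3
    exact ⟨h2.differentiableAt, (h1 h3).1⟩
  set h := hd.hasStrictDerivAt.localInverse _ _ _ hne with hh
  have ha : AnalyticAt ℂ h (T ζ) := hd.analyticAt_localInverse hne
  have h0 : h (T ζ) = ζ := HasStrictFDerivAt.localInverse_apply_image ..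
  have hr : ∀ᶠ z in 𝓝 (T ζ), T (h z) = z := HasStrictDerivAt.eventually_right_inverse ..
  have hc : Tendsto h (𝓝 (T ζ)) (𝓝 ζ) := by
    have := ha.continuousAt.tendsto
    rwa [h0] at this
  refine ⟨h, ha, h0, ?_⟩
  filter_upwards [self_mem_nhdsWithin, nhdsWithin_le_nhds hr,
    nhdsWithin_le_nhds (hc.eventually hin), nhdsWithin_le_nhds (hc.eventually hout)]
    with z hz h1 h2 h3
  rw [h1] at h2 h3
  have hz1 : ‖z‖ < 1 := by simpa using hz
  have : ‖h z‖ < 1 := by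
    by_contra hcon
    exact absurd (h3 (not_lt.1 hcon)) (not_le.2 hz1)
  exact (h2 this).2.symm

/-! ### Holomorphic maps of the sphere in finite coordinates -/

namespace Sphere

theorem AllInverseBranchesDefined.mono {Ω D D' : Set (OnePoint ℂ)} {f : OnePoint ℂ → OnePoint ℂ}
    (h : AllInverseBranchesDefined Ω f D) (hD : D' ⊆ D) : AllInverseBranchesDefined Ω f D' := by
  intro z hz hfz
  obtain ⟨G, hG, hGz⟩ := h z hz (hD hfz)
  exact ⟨G, ⟨fun w hw => hG.holomorphic w (hD hw), fun w hw => hG.mapsTo (hD hw),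
    fun w hw => hG.right_inv w (hD hw)⟩, hGz⟩

theorem reflect_of_ne_zero {w : ℂ} (hw : w ≠ 0) :
    reflect w = (((starRingEnd ℂ w)⁻¹ : ℂ) : OnePoint ℂ) := if_neg hw

/-- A finite value of the reflection comes from the reflected point. -/
theorem eq_conj_inv_of_reflect_eq {u w : ℂ} (h : reflect u = (w : OnePoint ℂ)) :
    u ≠ 0 ∧ w = (starRingEnd ℂ u)⁻¹ := by
  by_cases hu : u = 0
  · rw [reflect, if_pos hu] at h
    exact absurd h (OnePoint.infty_ne_coe w)
  · rw [reflect_of_ne_zero hu] at h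
    exact ⟨hu, (OnePoint.coe_injective h).symm⟩

/-- The map of the sphere induced by `T : ℂ → ℂ`; its value at `∞` is arbitrary. -/
def lift (T : ℂ → ℂ) (p : OnePoint ℂ) : OnePoint ℂ := p.elim ∞ fun w => ((T w : ℂ) : OnePoint ℂ)

theorem lift_coe (T : ℂ → ℂ) (w : ℂ) : lift T (w : OnePoint ℂ) = ((T w : ℂ) : OnePoint ℂ) := rfl

theorem holomorphicAt_lift {T : ℂ → ℂ} {w : ℂ} (hT : AnalyticAt ℂ T w) :
    HolomorphicAt (lift T) (w : OnePoint ℂ) := by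
  refine ⟨OnePoint.continuousAt_coe.2 ?_, ?_⟩
  · exact OnePoint.continuous_coe.continuousAt.comp hT.continuousAt
  · have h1 : AnalyticAt ℂ (fun t : ℂ => T (w + t) - T w) 0 := by
      refine AnalyticAt.sub ?_ analyticAt_const
      exact AnalyticAt.comp (f := fun t : ℂ => w + t) (by simpa using hT) (by fun_prop)
    exact h1

/-- In finite coordinates, a holomorphic map of the sphere is analytic. -/
theorem HolomorphicAt.analyticAt {G : OnePoint ℂ → OnePoint ℂ} {k : ℂ → ℂ} {w : ℂ}
    (hG : HolomorphicAt G (w : OnePoint ℂ))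
    (hk : ∀ᶠ u : ℂ in 𝓝 w, G (u : OnePoint ℂ) = ((k u : ℂ) : OnePoint ℂ)) : AnalyticAt ℂ k w := by
  have h1 := hG.2
  rw [hk.self_of_nhds] at h1
  have ht : Tendsto (fun t : ℂ => w + t) (𝓝 0) (𝓝 w) := by
    have : Continuous fun t : ℂ => w + t := by fun_prop
    simpa using this.tendsto 0
  have h2 : AnalyticAt ℂ (fun t : ℂ => k (w + t) - k w) 0 := by
    refine h1.congr ?_
    filter_upwards [ht.eventually hk] with t h
    change coord _ (G ((w + t : ℂ) : OnePoint ℂ)) = _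
    rw [h]
    rfl
  have h3 : AnalyticAt ℂ ((fun t : ℂ => k (w + t) - k w) ∘ fun u => u - w) w :=
    AnalyticAt.comp (by simpa using h2) (by fun_prop)
  refine (h3.add (analyticAt_const (v := k w))).congr ?_
  filter_upwards with u
  simp

end Sphere

/-! ### The maximal meromorphic extension of an inner function -/

namespace InnerFun

theorem ext_coe_of_lt (g : ℂ → ℂ) {z : ℂ} (hz : ‖z‖ < 1) :
    ext g (z : OnePoint ℂ) = ((g z : ℂ) : OnePoint ℂ) := if_pos hz

theorem ext_coe_of_gt (g : ℂ → ℂ) {z : ℂ} (hz : 1 < ‖z‖) :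
    ext g (z : OnePoint ℂ) = Sphere.reflect (g (starRingEnd ℂ z)⁻¹) :=
  (if_neg (not_lt.2 hz.le)).trans (if_neg hz.ne')

theorem ext_coe_of_eq {g h : ℂ → ℂ} {z : ℂ} (hz : ‖z‖ = 1) (hh : ContinuousAt h z)
    (hgh : h =ᶠ[𝓝[Metric.ball 0 1] z] g) : ext g (z : OnePoint ℂ) = ((h z : ℂ) : OnePoint ℂ) := by
  have h1 : ext g (z : OnePoint ℂ) = ((extendFrom (Metric.ball 0 1) g z : ℂ) : OnePoint ℂ) :=
    (if_neg (not_lt.2 hz.ge)).trans (if_pos hz)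
  rw [h1, extendFrom_eq]
  · rw [closure_ball _ one_ne_zero]; simp [hz]
  · exact (hh.tendsto.mono_left nhdsWithin_le_nhds).congr' hgh

theorem coe_mem_extDomain {g : ℂ → ℂ} {z : ℂ} :
    (z : OnePoint ℂ) ∈ extDomain g ↔ z ∉ singularities g := by
  rw [extDomain, mem_compl_iff, OnePoint.coe_injective.mem_set_image]

theorem coe_mem_extDomain_of_norm_ne {g : ℂ → ℂ} {z : ℂ} (hz : ‖z‖ ≠ 1) :
    (z : OnePoint ℂ) ∈ extDomain g := coe_mem_extDomain.2 fun h => hz h.1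

end InnerFun

/-! ### Inverse branches across the unit circle -/

/-- `T` is a branch of the inverse of `g` on the part inside the unit disk of the disk `D(ξ, ρ)`
(centred on the unit circle), continued holomorphically across the unit circle by reflection. -/
structure IsReflectedBranch (g : ℂ → ℂ) (ξ : ℂ) (ρ : ℝ) (T : ℂ → ℂ) : Prop where
  differentiableOn : DifferentiableOn ℂ T (Metric.ball ξ ρ)
  of_lt : ∀ w ∈ Metric.ball ξ ρ, ‖w‖ < 1 → ‖T w‖ < 1 ∧ g (T w) = w
  of_eq : ∀ w ∈ Metric.ball ξ ρ, ‖w‖ = 1 → ‖T w‖ = 1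
  of_gt : ∀ w ∈ Metric.ball ξ ρ, 1 < ‖w‖ →
    1 < ‖T w‖ ∧ T w = (starRingEnd ℂ (T (starRingEnd ℂ w)⁻¹))⁻¹

namespace IsReflectedBranch

variable {g T : ℂ → ℂ} {ξ : ℂ} {ρ : ℝ}

/-- A reflected branch is an inverse branch of the meromorphic extension of `g`. On the unit circle
this includes that its values are not singularities of `g`: by the Hopf lemma it is locally
invertible, and its local inverse continues `g`. -/
theorem isInverseBranch (hT : IsReflectedBranch g ξ ρ T) (hξ : ‖ξ‖ = 1) :
    Sphere.IsInverseBranch (InnerFun.extDomain g) (InnerFun.ext g)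
      (Sphere.disk (ξ : OnePoint ℂ) ρ) (Sphere.lift T) := by
  obtain ⟨hTd, hTin, hTcirc, hTout⟩ := hT
  have hTa : ∀ w ∈ Metric.ball ξ ρ, AnalyticAt ℂ T w := fun w hw =>
    hTd.analyticAt (Metric.isOpen_ball.mem_nhds hw)
  have key : ∀ w ∈ Metric.ball ξ ρ, ((T w : ℂ) : OnePoint ℂ) ∈ InnerFun.extDomain g ∧
      InnerFun.ext g ((T w : ℂ) : OnePoint ℂ) = (w : OnePoint ℂ) := by
    intro w hw
    rcases lt_trichotomy ‖w‖ 1 with hw1 | hw1 | hw1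
    · obtain ⟨h1, h2⟩ := hTin w hw hw1
      refine ⟨InnerFun.coe_mem_extDomain_of_norm_ne h1.ne, ?_⟩
      rw [InnerFun.ext_coe_of_lt g h1, h2]
    · have hmem := Metric.isOpen_ball.mem_nhds hw
      have hT1 := hTcirc w hw hw1
      obtain ⟨k, hk, hkw, hkg⟩ := exists_analytic_continuation hw1 (hTa w hw) hT1
        (by filter_upwards [hmem] with u hu using hTin u hu)
        (by
          filter_upwards [hmem] with u hu hu1
          rcases hu1.eq_or_lt with e | e
          · exact (hTcirc u hu e.symm).ge
          · exact (hTout u hu e).1.le)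
      refine ⟨InnerFun.coe_mem_extDomain.2 fun hs => hs.2 ⟨k, hk, hkg⟩, ?_⟩
      rw [InnerFun.ext_coe_of_eq hT1 hk.continuousAt hkg, hkw]
    · obtain ⟨h1, h2⟩ := hTout w hw hw1
      refine ⟨InnerFun.coe_mem_extDomain_of_norm_ne h1.ne', ?_⟩
      have hin := hTin _ (conj_inv_mem_ball hξ hw hw1.le)
        (by rw [norm_conj_inv]; exact inv_lt_one_of_one_lt₀ hw1)
      have hw0 : (starRingEnd ℂ w)⁻¹ ≠ 0 := by
        rw [← norm_ne_zero_iff, norm_conj_inv]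
        have : 0 < ‖w‖ := by linarith
        positivity
      rw [InnerFun.ext_coe_of_gt g h1, h2, conj_inv_conj_inv, hin.2,
        Sphere.reflect_of_ne_zero hw0, conj_inv_conj_inv]
  refine ⟨?_, ?_, ?_⟩
  · rintro _ ⟨w, hw, rfl⟩
    exact Sphere.holomorphicAt_lift (hTa w hw)
  · rintro _ ⟨w, hw, rfl⟩
    exact (key w hw).1
  · rintro _ ⟨w, hw, rfl⟩
    exact (key w hw).2

/-- A reflected branch is a left inverse of `g` on every connected set which `g` maps into its
domain, as soon as it is one at a single point, by the identity theorem. -/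
theorem eqOn_comp (hT : IsReflectedBranch g ξ ρ T)
    (hg : DifferentiableOn ℂ g (Metric.ball 0 1)) {U : Set ℂ} (hUo : IsOpen U)
    (hU : IsPreconnected U) (hU1 : U ⊆ Metric.ball 0 1) (hgU : MapsTo g U (Metric.ball ξ ρ))
    {z₁ : ℂ} (hz₁ : z₁ ∈ U) (hgz₁ : ‖g z₁‖ < 1) (hTz₁ : T (g z₁) = z₁) :
    EqOn (fun u => T (g u)) id U := by
  have hd : DifferentiableOn ℂ (fun u => T (g u)) U :=
    hT.differentiableOn.comp (hg.mono hU1) hgU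
  have hginj : ∀ᶠ u in 𝓝 z₁, T (g u) = u := by
    have hga : AnalyticAt ℂ g z₁ :=
      hg.analyticAt (Metric.isOpen_ball.mem_nhds (hU1 hz₁))
    have hTat : DifferentiableAt ℂ T (g z₁) :=
      hT.differentiableOn.differentiableAt (Metric.isOpen_ball.mem_nhds (hgU hz₁))
    have hopen : ∀ᶠ w in 𝓝 (g z₁), g (T w) = w := by
      filter_upwards [Metric.isOpen_ball.mem_nhds (hgU hz₁),
        continuous_norm.continuousAt.eventually (gt_mem_nhds hgz₁)] with w hw hw1
        using (hT.of_lt w hw hw1).2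
    have hne : deriv g z₁ ≠ 0 := by
      have e1 : HasDerivAt g (deriv g z₁) (T (g z₁)) := by
        rw [hTz₁]; exact hga.differentiableAt.hasDerivAt
      have e2 := (e1.comp _ hTat.hasDerivAt).unique
        ((hasDerivAt_id _).congr_of_eventuallyEq hopen)
      intro h0
      rw [h0, zero_mul] at e2
      exact zero_ne_one e2
    set l := hga.hasStrictDerivAt.localInverse _ _ _ hne
    have hli : ∀ᶠ u in 𝓝 z₁, l (g u) = u :=
      HasStrictDerivAt.eventually_left_inverse ..
    have hTg : Tendsto (fun u => T (g u)) (𝓝 z₁) (𝓝 z₁) := by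
      have := hTat.continuousAt.comp hga.continuousAt
      have h := this.tendsto
      simp only [Function.comp_def, hTz₁] at h
      exact h
    filter_upwards [hli, hTg.eventually hli, hga.continuousAt.eventually hopen] with u a b c
    rw [← b, c, a]
  exact (hd.analyticOnNhd hUo).eqOn_of_preconnected_of_eventuallyEq
    (differentiableOn_id.analyticOnNhd hUo) hU hz₁ hginj

end IsReflectedBranch

/-! ### Inner functions -/

namespace IsInner

/-- An analytic continuation of an inner function to a point of the unit circle has modulus one
there: radial limits of modulus one are dense. -/
theorem norm_continuation_eq_one {g h : ℂ → ℂ} (hg : IsInner g) {z : ℂ} (hz : ‖z‖ = 1)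
    (hh : AnalyticAt ℂ h z) (hgh : h =ᶠ[𝓝[Metric.ball 0 1] z] g) : ‖h z‖ = 1 := by
  let e : ℝ → ℂ := fun θ => Complex.exp ((θ : ℂ) * Complex.I)
  have he : Continuous e := by fun_prop
  have hez : e (Complex.arg z) = z := by
    have := Complex.norm_mul_exp_arg_mul_I z
    rwa [hz, Complex.ofReal_one, one_mul] at this
  have hen : ∀ θ, ‖e θ‖ = 1 := fun θ => Complex.norm_exp_ofReal_mul_I θ
  have hev : ∀ᶠ u in 𝓝 z, ContinuousAt h u ∧ (h =ᶠ[𝓝[Metric.ball 0 1] u] g) := by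
    obtain ⟨U, hU, hUo, hzU⟩ := eventually_nhds_iff.1 (eventually_nhdsWithin_iff.1 hgh)
    filter_upwards [hh.eventually_analyticAt, hUo.mem_nhds hzU] with u h1 h2
    refine ⟨h1.continuousAt, eventually_nhdsWithin_iff.2 ?_⟩
    filter_upwards [hUo.mem_nhds h2] with x hx using hU x hx
  have hfreq : ∃ᶠ θ in 𝓝 (Complex.arg z), ‖h (e θ)‖ = 1 := by
    have hdense := MeasureTheory.Measure.dense_of_ae hg.radial
    have h1 : ∃ᶠ θ in 𝓝 (Complex.arg z), ∃ w : ℂ, ‖w‖ = 1 ∧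
        Tendsto (fun r : ℝ => g ((r : ℂ) * e θ)) (𝓝[<] 1) (𝓝 w) :=
      mem_closure_iff_frequently.1 (hdense (Complex.arg z))
    have h2 := he.continuousAt.tendsto (x := Complex.arg z)
    rw [hez] at h2
    refine (h1.and_eventually (h2.eventually hev)).mono ?_
    rintro θ ⟨⟨w, hw, hlim⟩, hc, hθ⟩
    have hr : Tendsto (fun r : ℝ => (r : ℂ) * e θ) (𝓝[<] 1) (𝓝[Metric.ball 0 1] (e θ)) := by
      refine tendsto_nhdsWithin_iff.2 ⟨?_, ?_⟩
      · have : Continuous fun r : ℝ => (r : ℂ) * e θ := by fun_prop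
        have h3 := this.tendsto 1
        simp only [Complex.ofReal_one, one_mul] at h3
        exact h3.mono_left nhdsWithin_le_nhds
      · filter_upwards [Ioo_mem_nhdsLT (zero_lt_one' ℝ)] with r hr
        rw [mem_ball_zero_iff, norm_mul, hen, mul_one, Complex.norm_real,
          Real.norm_of_nonneg hr.1.le]
        exact hr.2
    have h4 : Tendsto (fun r : ℝ => g ((r : ℂ) * e θ)) (𝓝[<] 1) (𝓝 (h (e θ))) :=
      ((hc.tendsto.mono_left nhdsWithin_le_nhds).congr' hθ).comp hr
    rw [tendsto_nhds_unique h4 hlim, hw]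
  have hcont : Tendsto (fun θ => ‖h (e θ)‖) (𝓝 (Complex.arg z)) (𝓝 ‖h z‖) := by
    have h1 : ContinuousAt h (e (Complex.arg z)) := by rw [hez]; exact hh.continuousAt
    have h2 := (h1.comp he.continuousAt).norm.tendsto
    simp only [Function.comp_apply, hez] at h2
    exact h2
  exact isClosed_singleton.mem_of_frequently_of_tendsto (s := {(1 : ℝ)}) hfreq hcont

variable {g : ℂ → ℂ} (hg : IsInner g)
include hg

/-- The extension of an inner function takes values in the unit disk only in the unit disk. -/
theorem exists_of_ext_eq {p : OnePoint ℂ} (hp : p ∈ InnerFun.extDomain g) {w : ℂ} (hw : ‖w‖ < 1)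
    (h : InnerFun.ext g p = (w : OnePoint ℂ)) :
    ∃ z : ℂ, p = (z : OnePoint ℂ) ∧ ‖z‖ < 1 ∧ g z = w := by
  have hout : ∀ z : ℂ, ‖z‖ < 1 → Sphere.reflect (g z) ≠ (w : OnePoint ℂ) := by
    intro z hz hz'
    obtain ⟨h1, h2⟩ := Sphere.eq_conj_inv_of_reflect_eq hz'
    have h3 : ‖g z‖ < 1 := mem_ball_zero_iff.1 (hg.mapsTo (mem_ball_zero_iff.2 hz))
    rw [h2, norm_conj_inv] at hw
    exact absurd hw (not_lt.2 ((one_le_inv₀ (norm_pos_iff.2 h1)).2 h3.le))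
  induction p using OnePoint.rec with
  | infty => exact absurd h (hout 0 (by simp))
  | coe z =>
    rcases lt_trichotomy ‖z‖ 1 with hz | hz | hz
    · rw [InnerFun.ext_coe_of_lt g hz] at h
      exact ⟨z, rfl, hz, OnePoint.coe_injective h⟩
    · have h1 := InnerFun.coe_mem_extDomain.1 hp
      obtain ⟨k, hk, hkg⟩ : ∃ k : ℂ → ℂ, AnalyticAt ℂ k z ∧ k =ᶠ[𝓝[Metric.ball 0 1] z] g := by
        by_contra hcon
        exact h1 ⟨hz, hcon⟩
      rw [InnerFun.ext_coe_of_eq hz hk.continuousAt hkg] at h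
      have h2 := hg.norm_continuation_eq_one hz hk hkg
      rw [OnePoint.coe_injective h] at h2
      exact absurd hw h2.not_lt
    · rw [InnerFun.ext_coe_of_gt g hz] at h
      refine absurd h (hout _ ?_)
      rw [norm_conj_inv]
      exact inv_lt_one_of_one_lt₀ hz

/-- Inverse branches on a disk inside the unit disk, as functions of a complex variable. -/
theorem exists_inverse_of_allInverseBranchesDefined {v : ℂ} {r : ℝ}
    (hsub : Metric.ball v r ⊆ Metric.ball 0 1)
    (h : InnerFun.AllInverseBranchesDefined g (Sphere.disk (v : OnePoint ℂ) r))
    {z : ℂ} (hz : z ∈ Metric.ball (0 : ℂ) 1) (hgz : g z ∈ Metric.ball v r) :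
    ∃ k : ℂ → ℂ, DifferentiableOn ℂ k (Metric.ball v r) ∧
      MapsTo k (Metric.ball v r) (Metric.ball 0 1) ∧
      (∀ w ∈ Metric.ball v r, g (k w) = w) ∧ k (g z) = z := by
  have hz1 : ‖z‖ < 1 := mem_ball_zero_iff.1 hz
  have he := InnerFun.ext_coe_of_lt g hz1
  obtain ⟨G, hG, hGz⟩ := h (z : OnePoint ℂ) (InnerFun.coe_mem_extDomain_of_norm_ne hz1.ne)
    (by rw [he]; exact ⟨_, hgz, rfl⟩)
  have hex : ∀ w ∈ Metric.ball v r, ∃ u : ℂ, G (w : OnePoint ℂ) = (u : OnePoint ℂ) ∧ ‖u‖ < 1 ∧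
      g u = w := fun w hw =>
    hg.exists_of_ext_eq (hG.mapsTo ⟨w, hw, rfl⟩) (mem_ball_zero_iff.1 (hsub hw))
      (hG.right_inv _ ⟨w, hw, rfl⟩)
  choose! k hkG hk1 hkg using hex
  refine ⟨k, fun w hw => ?_, fun w hw => mem_ball_zero_iff.2 (hk1 w hw), hkg, ?_⟩
  · have := (hG.holomorphic _ ⟨w, hw, rfl⟩).analyticAt (k := k)
      (by filter_upwards [Metric.isOpen_ball.mem_nhds hw] with u hu using hkG u hu)
    exact this.differentiableAt.differentiableWithinAt
  · rw [he, hkG _ hgz] at hGz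
    exact OnePoint.coe_injective hGz

/-- If all values in the unit disk close to `ξ` are regular, then `ξ` is regular: the inverse
branches extend by monodromy to the part of the unit disk close to `ξ`, and then across the unit
circle by reflection, to a disk whose radius does not depend on the branch. -/
theorem isRegularValue_of_forall_mem {ξ : ℂ} (hξ : ‖ξ‖ = 1) {r : ℝ} (hr : 0 < r)
    (h : ∀ v ∈ Metric.ball ξ r ∩ Metric.ball 0 1,
      Sphere.IsRegularValue (InnerFun.extDomain g) (InnerFun.ext g) (v : OnePoint ℂ)) :
    ∃ ρ : ℝ, 0 < ρ ∧
      InnerFun.AllInverseBranchesDefined g (Sphere.disk (ξ : OnePoint ℂ) ρ) := by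
  have hg0 : ‖g 0‖ < 1 := mem_ball_zero_iff.1 (hg.mapsTo (Metric.mem_ball_self one_pos))
  set κ := (1 - ‖g 0‖) / 4 with hκdef
  have hκ : 0 < κ := by rw [hκdef]; linarith
  have hκg : ∀ z : ℂ, ‖z‖ < 1 → κ * (1 - ‖z‖) ≤ 1 - ‖g z‖ := by
    intro z hz
    have := one_sub_norm_ge hg.differentiableOn hg.mapsTo (mem_ball_zero_iff.2 hz)
    simpa using this
  set ρ := min (r / 2) κ
  have hρ : 0 < ρ := by positivity
  have hρκ : ρ ≤ κ := min_le_right _ _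
  have hρr : 2 * ρ ≤ r := by linarith [min_le_left (r / 2) κ]
  set W := Metric.ball ξ (2 * ρ) ∩ Metric.ball 0 1 with hW
  have hWo : IsOpen W := Metric.isOpen_ball.inter Metric.isOpen_ball
  have hWin : ∀ w ∈ Metric.ball ξ ρ, ‖w‖ < 1 → w ∈ W := fun w hw hw1 =>
    ⟨Metric.ball_subset_ball (by linarith) hw, mem_ball_zero_iff.2 hw1⟩
  have hlocal : ∀ v ∈ W, ∃ s > 0, ∀ z ∈ Metric.ball (0 : ℂ) 1, g z ∈ Metric.ball v s →
      ∃ k : ℂ → ℂ, DifferentiableOn ℂ k (Metric.ball v s) ∧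
        MapsTo k (Metric.ball v s) (Metric.ball 0 1) ∧
        (∀ w ∈ Metric.ball v s, g (k w) = w) ∧ k (g z) = z := by
    intro v hv
    obtain ⟨s₁, hs₁, hall⟩ := h v ⟨Metric.ball_subset_ball hρr hv.1, hv.2⟩
    obtain ⟨s₂, hs₂, hsub⟩ := Metric.isOpen_iff.1 Metric.isOpen_ball v hv.2
    refine ⟨min s₁ s₂, lt_min hs₁ hs₂, fun z hz hgz => ?_⟩
    refine hg.exists_inverse_of_allInverseBranchesDefined
      ((Metric.ball_subset_ball (min_le_right _ _)).trans hsub) ?_ hz hgz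
    exact Sphere.AllInverseBranchesDefined.mono hall
      (image_mono (Metric.ball_subset_ball (min_le_left _ _)))
  -- Through every point of the disk above `W` there is a branch defined across the circle.
  have hbranch : ∀ z : ℂ, ‖z‖ < 1 → g z ∈ W → ∃ T : ℂ → ℂ,
      IsReflectedBranch g ξ ρ T ∧ (g z ∈ Metric.ball ξ ρ → T (g z) = z) := by
    intro z hz hgz
    obtain ⟨G, hGd, hGm, hGg, hGz⟩ := exists_inverse_on_convex hg.differentiableOn hWo
      ((convex_ball _ _).inter (convex_ball _ _)) hlocal (mem_ball_zero_iff.2 hz) hgz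
    obtain ⟨T, hTd, hTin, hTcirc, hTout⟩ := exists_reflection hξ hκ hρκ hGd hGm (fun w hw => by
      have := hκg (G w) (mem_ball_zero_iff.1 (hGm hw))
      rwa [hGg w hw] at this)
    refine ⟨T, ⟨hTd, fun w hw hw1 => ?_, hTcirc, fun w hw hw1 => ?_⟩, fun hgz' => ?_⟩
    · rw [hTin w hw hw1]
      exact ⟨mem_ball_zero_iff.1 (hGm (hWin w hw hw1)), hGg w (hWin w hw hw1)⟩
    · refine ⟨(hTout w hw hw1).1, ?_⟩
      rw [hTin _ (conj_inv_mem_ball hξ hw hw1.le)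
        (by rw [norm_conj_inv]; exact inv_lt_one_of_one_lt₀ hw1)]
      exact (hTout w hw hw1).2
    · rw [hTin _ hgz' (mem_ball_zero_iff.1 hgz.2), hGz]
  refine ⟨ρ, hρ, fun p hp hpD => ?_⟩
  obtain ⟨w, hw, hpw⟩ := hpD
  change (w : OnePoint ℂ) = InnerFun.ext g p at hpw
  rw [← hpw]
  -- A value of the reflected function in the disk around `ξ` is the reflection of a value in `W`.
  have houter : ∀ z : ℂ, ‖z‖ < 1 → Sphere.reflect (g z) = (w : OnePoint ℂ) →
      1 < ‖w‖ ∧ (starRingEnd ℂ w)⁻¹ = g z ∧ g z ∈ Metric.ball ξ ρ ∧ g z ∈ W := by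
    intro z hz hzw
    obtain ⟨h1, h2⟩ := Sphere.eq_conj_inv_of_reflect_eq hzw
    have h3 : ‖g z‖ < 1 := mem_ball_zero_iff.1 (hg.mapsTo (mem_ball_zero_iff.2 hz))
    have h4 : 1 < ‖w‖ := by
      rw [h2, norm_conj_inv]
      exact (one_lt_inv₀ (norm_pos_iff.2 h1)).2 h3
    have h5 : (starRingEnd ℂ w)⁻¹ = g z := by rw [h2, conj_inv_conj_inv]
    have h6 : g z ∈ Metric.ball ξ ρ := h5 ▸ conj_inv_mem_ball hξ hw h4.le
    exact ⟨h4, h5, h6, hWin _ h6 h3⟩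
  induction p using OnePoint.rec with
  | infty =>
    -- The value `g 0` is too far from `ξ` for `∞` to be sent close to `ξ`.
    exfalso
    obtain ⟨-, -, h1, -⟩ := houter 0 (by simp) hpw.symm
    have h2 := norm_sub_norm_le ξ (g 0)
    have h3 := mem_ball_iff_norm'.1 h1
    have h4 := hκg 0 (by simp)
    rw [norm_zero] at h4
    linarith
  | coe z =>
    rcases lt_trichotomy ‖z‖ 1 with hz | hz | hz
    · rw [InnerFun.ext_coe_of_lt g hz] at hpw
      have hwz : w = g z := OnePoint.coe_injective hpw
      subst hwz
      obtain ⟨T, hT, hTz⟩ := hbranch z hz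
        (hWin _ hw (mem_ball_zero_iff.1 (hg.mapsTo (mem_ball_zero_iff.2 hz))))
      exact ⟨_, hT.isInverseBranch hξ, by rw [Sphere.lift_coe, hTz hw]⟩
    · obtain ⟨k, hk, hkg⟩ : ∃ k : ℂ → ℂ, AnalyticAt ℂ k z ∧ k =ᶠ[𝓝[Metric.ball 0 1] z] g := by
        by_contra hcon
        exact InnerFun.coe_mem_extDomain.1 hp ⟨hz, hcon⟩
      rw [InnerFun.ext_coe_of_eq hz hk.continuousAt hkg] at hpw
      have hwk : w = k z := OnePoint.coe_injective hpw
      subst hwk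
      have hkU : ∀ᶠ u in 𝓝 z, k u ∈ Metric.ball ξ ρ ∧ (u ∈ Metric.ball (0 : ℂ) 1 → k u = g u) :=
        (hk.continuousAt.eventually (Metric.isOpen_ball.mem_nhds hw)).and
          (eventually_nhdsWithin_iff.1 hkg)
      obtain ⟨δ, hδ, hδU⟩ := Metric.eventually_nhds_iff_ball.1 hkU
      set U := Metric.ball z δ ∩ Metric.ball 0 1 with hU
      have hUo : IsOpen U := Metric.isOpen_ball.inter Metric.isOpen_ball
      have hUn : ∀ u ∈ U, ‖u‖ < 1 := fun u hu => mem_ball_zero_iff.1 hu.2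
      have hgU : ∀ u ∈ U, g u ∈ Metric.ball ξ ρ ∧ ‖g u‖ < 1 := fun u hu => by
        have h1 := hδU u hu.1
        refine ⟨?_, mem_ball_zero_iff.1 (hg.mapsTo hu.2)⟩
        rw [← h1.2 hu.2]; exact h1.1
      have hzcl : z ∈ closure U := Metric.isOpen_ball.inter_closure
        ⟨Metric.mem_ball_self hδ, by rw [closure_ball _ one_ne_zero]; simp [hz]⟩
      obtain ⟨z₁, hz₁⟩ : U.Nonempty := closure_nonempty_iff.1 ⟨z, hzcl⟩
      obtain ⟨T, hT, hTz⟩ := hbranch z₁ (hUn _ hz₁)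
        (hWin _ (hgU _ hz₁).1 (hgU _ hz₁).2)
      refine ⟨_, hT.isInverseBranch hξ, ?_⟩
      rw [Sphere.lift_coe]
      congr 1
      have hTz₁ : T (g z₁) = z₁ := hTz (hgU _ hz₁).1
      -- The branch through `z₁` inverts `g` near `z₁`, hence on all of `U`, hence at `z`.
      have heq : EqOn (fun u => T (g u)) id U := hT.eqOn_comp hg.differentiableOn hUo
        ((convex_ball _ _).inter (convex_ball _ _)).isPreconnected inter_subset_right
        (fun u hu => (hgU u hu).1) hz₁ (hgU _ hz₁).2 hTz₁
      have hTk : Tendsto (fun u => T (k u)) (𝓝[U] z) (𝓝 (T (k z))) := by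
        have hTat : ContinuousAt T (k z) :=
          (hT.differentiableOn.differentiableAt (Metric.isOpen_ball.mem_nhds hw)).continuousAt
        exact (hTat.comp hk.continuousAt).tendsto.mono_left nhdsWithin_le_nhds
      have hid : Tendsto (fun u => T (k u)) (𝓝[U] z) (𝓝 z) := by
        refine (tendsto_id.mono_left nhdsWithin_le_nhds).congr' ?_
        filter_upwards [self_mem_nhdsWithin] with u hu
        rw [(hδU u hu.1).2 hu.2]
        exact (heq hu).symm
      have : (𝓝[U] z).NeBot := mem_closure_iff_nhdsWithin_neBot.1 hzcl
      exact tendsto_nhds_unique hTk hid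
    · rw [InnerFun.ext_coe_of_gt g hz] at hpw
      have hz' : ‖(starRingEnd ℂ z)⁻¹‖ < 1 := by
        rw [norm_conj_inv]; exact inv_lt_one_of_one_lt₀ hz
      obtain ⟨hw1, hwz, hb, hWz⟩ := houter _ hz' hpw.symm
      obtain ⟨T, hT, hTz⟩ := hbranch _ hz' hWz
      refine ⟨_, hT.isInverseBranch hξ, ?_⟩
      rw [Sphere.lift_coe, (hT.of_gt w hw hw1).2, hwz, hTz hb, conj_inv_conj_inv]

end IsInner

/-! ### Crosscut neighbourhoods -/

/-- A crosscut neighbourhood of `ξ` contains all points of the unit disk close to `ξ`. -/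
theorem IsCrosscutNhd.exists_ball_subset {N : Set ℂ} {ξ : ℂ} (hN : IsCrosscutNhd N ξ)
    (hξ : ‖ξ‖ = 1) : ∃ r > 0, Metric.ball ξ r ∩ Metric.ball 0 1 ⊆ N := by
  obtain ⟨hNo, -, hN1, hξN, a, b, ⟨-, -, -, -, γ, hγ, -, hγ0, hγ1, hγC⟩, hξa, hξb⟩ := hN
  have hξγ : ξ ∉ γ '' Icc 0 1 := by
    rintro ⟨t, ht, rfl⟩
    rcases ht.1.eq_or_lt with h0 | h0
    · exact hξa (by rw [← h0, hγ0])
    rcases ht.2.eq_or_lt with h1 | h1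
    · exact hξb (by rw [h1, hγ1])
    have h2 : γ t ∈ γ '' Ioo 0 1 := ⟨t, ⟨h0, h1⟩, rfl⟩
    rw [hγC] at h2
    have := mem_ball_zero_iff.1 h2.2
    linarith
  have hcl : IsClosed (γ '' Icc 0 1) := (isCompact_Icc.image_of_continuousOn hγ).isClosed
  obtain ⟨r, hr, hrγ⟩ := Metric.isOpen_iff.1 hcl.isOpen_compl ξ hξγ
  refine ⟨r, hr, ?_⟩
  have hfr : Metric.ball ξ r ∩ Metric.ball 0 1 ⊆ (frontier N)ᶜ := by
    rintro z ⟨hz, hz1⟩ hzN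
    have h2 : z ∈ frontier N ∩ Metric.ball 0 1 := ⟨hzN, hz1⟩
    rw [← hγC] at h2
    exact hrγ hz (image_mono Ioo_subset_Icc_self h2)
  have hpre : IsPreconnected (Metric.ball ξ r ∩ Metric.ball 0 1) :=
    ((convex_ball _ _).inter (convex_ball _ _)).isPreconnected
  obtain ⟨z, hzN, hz⟩ : ((Metric.ball ξ r ∩ Metric.ball 0 1) ∩ N).Nonempty := by
    obtain ⟨z, hz, hzN⟩ := mem_closure_iff.1 (frontier_subset_closure hξN) _ Metric.isOpen_ball
      (Metric.mem_ball_self hr)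
    exact ⟨z, ⟨hz, hN1 hzN⟩, hzN⟩
  refine hpre.subset_left_of_subset_union hNo (isClosed_closure (s := N)).isOpen_compl ?_ ?_ ⟨z, hzN, hz⟩
  · exact disjoint_left.2 fun u hu hu' => hu' (subset_closure hu)
  · intro u hu
    by_cases h : u ∈ N
    · exact Or.inl h
    · refine Or.inr fun hc => hfr hu ?_
      rw [hNo.frontier_eq]
      exact ⟨hc, h⟩

/-- The caps cut off the unit disk by chords are arbitrarily small crosscut neighbourhoods. -/
theorem exists_isCrosscutNhd_subset_ball {ξ : ℂ} (hξ : ‖ξ‖ = 1) {ρ : ℝ} (hρ : 0 < ρ) :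
    ∃ N : Set ℂ, IsCrosscutNhd N ξ ∧ N ⊆ Metric.ball ξ ρ := by
  obtain ⟨c, hc0, hc1, hcρ⟩ : ∃ c : ℝ, 0 < c ∧ c < 1 ∧ 2 * (1 - c) ≤ ρ ^ 2 := by
    have h1 := min_le_left (1 / 2 : ℝ) (ρ ^ 2 / 2)
    have h2 := min_le_right (1 / 2 : ℝ) (ρ ^ 2 / 2)
    have h3 : 0 < min (1 / 2 : ℝ) (ρ ^ 2 / 2) := by positivity
    exact ⟨1 - min (1 / 2) (ρ ^ 2 / 2), by linarith, by linarith, by linarith⟩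
  have hξ0 : ξ ≠ 0 := by rw [← norm_ne_zero_iff, hξ]; exact one_ne_zero
  have hξξ : starRingEnd ℂ ξ * ξ = 1 := by
    rw [← Complex.normSq_eq_conj_mul_self, Complex.normSq_eq_norm_sq, hξ]; simp
  let ℓ : ℂ → ℝ := fun z => (starRingEnd ℂ ξ * z).re
  have hℓ : Continuous ℓ := by fun_prop
  have hrot : ∀ z : ℂ, ‖starRingEnd ℂ ξ * z‖ = ‖z‖ := fun z => by
    rw [norm_mul, RCLike.norm_conj, hξ, one_mul]
  have hback : ∀ z : ℂ, ξ * (starRingEnd ℂ ξ * z) = z := fun z => by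
    rw [← mul_assoc, mul_comm ξ, hξξ, one_mul]
  have hℓξ : ∀ u : ℂ, starRingEnd ℂ ξ * (ξ * u) = u := fun u => by
    rw [← mul_assoc, hξξ, one_mul]
  set N : Set ℂ := {z | c < ℓ z} ∩ Metric.ball 0 1 with hN
  have hNo : IsOpen N := (isOpen_lt continuous_const hℓ).inter Metric.isOpen_ball
  have hconv : Convex ℝ N := by
    refine Convex.inter ?_ (convex_ball _ _)
    have : IsLinearMap ℝ ℓ :=
      ⟨fun x y => by simp only [ℓ, mul_add, Complex.add_re], fun t x => by simp [ℓ]; ring⟩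
    exact convex_halfSpace_gt this c
  have hseg : ∀ {t : ℝ}, c < t → t < 1 → (t : ℂ) * ξ ∈ N := by
    intro t h1 h2
    refine ⟨?_, ?_⟩
    · have : ℓ ((t : ℂ) * ξ) = t := by
        simp only [ℓ]
        rw [mul_comm (t : ℂ), hℓξ, Complex.ofReal_re]
      change c < ℓ ((t : ℂ) * ξ)
      rw [this]; exact h1
    · rw [mem_ball_zero_iff, norm_mul, hξ, mul_one, Complex.norm_real,
        Real.norm_of_nonneg (by linarith)]
      exact h2
  have hξcl : ξ ∈ closure N := by
    have : Continuous fun t : ℝ => (t : ℂ) * ξ := by fun_prop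
    have h1 := (this.tendsto 1).mono_left (nhdsWithin_le_nhds (s := Iio 1))
    simp only [Complex.ofReal_one, one_mul] at h1
    refine mem_closure_of_tendsto h1 ?_
    filter_upwards [Ioo_mem_nhdsLT hc1] with t ht using hseg ht.1 ht.2
  have hfr : frontier N ∩ Metric.ball 0 1 = {z | ℓ z = c} ∩ Metric.ball 0 1 := by
    rw [hNo.frontier_eq]
    ext z
    constructor
    · rintro ⟨⟨h1, h2⟩, h3⟩
      have h4 : c ≤ ℓ z := closure_minimal (fun u hu => (le_of_lt hu.1 : c ≤ ℓ u))
        (isClosed_le continuous_const hℓ) h1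
      have h5 : ¬ c < ℓ z := fun h => h2 ⟨h, h3⟩
      exact ⟨le_antisymm (not_lt.1 h5) h4, h3⟩
    · rintro ⟨h1, h3⟩
      have h1' : ℓ z = c := h1
      refine ⟨⟨?_, fun h => (ne_of_gt h.1) h1'⟩, h3⟩
      have hcont : Continuous fun t : ℝ => z + (t : ℂ) * ξ := by fun_prop
      have h2 := (hcont.tendsto 0).mono_left (nhdsWithin_le_nhds (s := Ioi 0))
      simp only [Complex.ofReal_zero, zero_mul, add_zero] at h2
      refine mem_closure_of_tendsto h2 ?_
      filter_upwards [self_mem_nhdsWithin, h2.eventually (Metric.isOpen_ball.mem_nhds h3)]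
        with t ht hb
      refine ⟨?_, hb⟩
      have : ℓ (z + (t : ℂ) * ξ) = c + t := by
        have e : ℓ (z + (t : ℂ) * ξ) = ℓ z + t := by
          simp only [ℓ]
          rw [mul_add, mul_comm (t : ℂ), hℓξ, Complex.add_re, Complex.ofReal_re]
        rw [e, h1']
      change c < ℓ (z + (t : ℂ) * ξ)
      rw [this]
      have : (0 : ℝ) < t := ht
      linarith
  -- The chord from `ξ (c + i s)` to `ξ (c - i s)`, in the coordinate `u = conj ξ * z`.
  set s := Real.sqrt (1 - c ^ 2) with hs
  have hs2 : s ^ 2 = 1 - c ^ 2 := Real.sq_sqrt (by nlinarith)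
  have hs0 : 0 < s := Real.sqrt_pos.2 (by nlinarith)
  let u : ℝ → ℂ := fun t => ⟨c, s * (1 - 2 * t)⟩
  have hu : Continuous u := by
    have : u = fun t : ℝ => (c : ℂ) + ((s * (1 - 2 * t) : ℝ) : ℂ) * Complex.I := by
      ext t
      exact (Complex.mk_eq_add_mul_I _ _)
    rw [this]; fun_prop
  have hun : ∀ t, ‖u t‖ ^ 2 = c ^ 2 + s ^ 2 * (1 - 2 * t) ^ 2 := fun t => by
    rw [Complex.sq_norm, Complex.normSq_apply]; ring
  have hu1 : ∀ t, ‖u t‖ < 1 ↔ t ∈ Ioo (0 : ℝ) 1 := by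
    intro t
    have h1 : ‖u t‖ < 1 ↔ ‖u t‖ ^ 2 < 1 := by
      rw [sq_lt_one_iff₀ (norm_nonneg _)]
    have h2 : 1 - ‖u t‖ ^ 2 = 4 * s ^ 2 * (t * (1 - t)) := by rw [hun]; nlinarith
    have h3 : ‖u t‖ ^ 2 < 1 ↔ 0 < t * (1 - t) := by
      rw [← sub_pos, h2]
      exact mul_pos_iff_of_pos_left (by positivity)
    rw [h1, h3]
    constructor
    · intro h
      constructor <;> nlinarith
    · rintro ⟨h, h'⟩
      exact mul_pos h (by linarith)
  have hend : ∀ t, (1 - 2 * t) ^ 2 = 1 → ‖ξ * u t‖ = 1 := fun t ht => by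
    have h1 := hun t
    rw [ht, hs2] at h1
    rw [norm_mul, hξ, one_mul]
    have : ‖u t‖ ^ 2 = 1 := by linarith
    exact (pow_eq_one_iff_of_nonneg (norm_nonneg _) two_ne_zero).1 this
  have hune : ∀ t, ξ ≠ ξ * u t := fun t h => by
    have h1 : u t = 1 := mul_left_cancel₀ hξ0 (by rw [← h, mul_one])
    have h2 : (u t).re = 1 := by rw [h1, Complex.one_re]
    exact hc1.ne h2
  have huinj : Function.Injective u := fun t t' h => by
    have h1 : s * (1 - 2 * t) = s * (1 - 2 * t') := congrArg Complex.im h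
    have := mul_left_cancel₀ hs0.ne' h1
    linarith
  refine ⟨N, ⟨hNo, ⟨⟨_, hseg (t := (c + 1) / 2) (by linarith) (by linarith)⟩,
    hconv.isPreconnected⟩, inter_subset_right, ?_, ξ * u 0, ξ * u 1, ?_, hune 0, hune 1⟩, ?_⟩
  · rw [hNo.frontier_eq]
    exact ⟨hξcl, fun h => (mem_ball_zero_iff.1 h.2).ne hξ⟩
  · refine ⟨hend 0 (by norm_num), hend 1 (by norm_num), fun h => ?_, inter_subset_right,
      fun t => ξ * u t, by fun_prop, fun t _ t' _ h => huinj (mul_left_cancel₀ hξ0 h), rfl, rfl, ?_⟩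
    · exact zero_ne_one (huinj (mul_left_cancel₀ hξ0 h))
    · rw [hfr]
      ext z
      constructor
      · rintro ⟨t, ht, rfl⟩
        refine ⟨?_, ?_⟩
        · change (starRingEnd ℂ ξ * (ξ * u t)).re = c
          rw [hℓξ]
        · rw [mem_ball_zero_iff, norm_mul, hξ, one_mul]
          exact (hu1 t).2 ht
      · rintro ⟨h1, h2⟩
        have e : u ((1 - (starRingEnd ℂ ξ * z).im / s) / 2) = starRingEnd ℂ ξ * z := by
          refine Complex.ext (Eq.symm h1) ?_
          change s * (1 - 2 * ((1 - (starRingEnd ℂ ξ * z).im / s) / 2)) = _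
          field_simp
          ring
        refine ⟨(1 - (starRingEnd ℂ ξ * z).im / s) / 2, (hu1 _).1 ?_, ?_⟩
        · rw [e, hrot]; exact mem_ball_zero_iff.1 h2
        · change ξ * u _ = z
          rw [e, hback]
  · rintro z ⟨h1, h2⟩
    have h1' : c < (starRingEnd ℂ ξ * z).re := h1
    have h2' : ‖z‖ < 1 := mem_ball_zero_iff.1 h2
    rw [mem_ball_iff_norm]
    refine lt_of_pow_lt_pow_left₀ 2 hρ.le ?_
    have e : ‖z - ξ‖ ^ 2 = ‖starRingEnd ℂ ξ * z‖ ^ 2 - 2 * (starRingEnd ℂ ξ * z).re + 1 := by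
      rw [← hrot (z - ξ), mul_sub, hξξ, Complex.sq_norm, Complex.sq_norm, Complex.normSq_apply,
        Complex.normSq_apply]
      simp only [Complex.sub_re, Complex.sub_im, Complex.one_re, Complex.one_im]
      ring
    rw [e, hrot]
    nlinarith [norm_nonneg z]

theorem proposition4p2 (g : ℂ → ℂ) (hg : IsInner g) (ξ : ℂ) (hξ : ‖ξ‖ = 1) :
    (∃ N : Set ℂ, IsCrosscutNhd N ξ ∧
      InnerFun.SV g ∩ (fun z : ℂ => (z : OnePoint ℂ)) '' N = ∅) ↔
    ∃ ρ : ℝ, 0 < ρ ∧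
      InnerFun.AllInverseBranchesDefined g (Sphere.disk (ξ : OnePoint ℂ) ρ) := by
  constructor
  · rintro ⟨N, hN, hSV⟩
    obtain ⟨r, hr, hrN⟩ := hN.exists_ball_subset hξ
    refine hg.isRegularValue_of_forall_mem hξ hr fun v hv => ?_
    by_contra hcon
    have : (v : OnePoint ℂ) ∈ InnerFun.SV g ∩ (fun z : ℂ => (z : OnePoint ℂ)) '' N :=
      ⟨hcon, v, hrN hv, rfl⟩
    rw [hSV] at this
    exact this
  · rintro ⟨ρ, hρ, h⟩
    obtain ⟨N, hN, hNρ⟩ := exists_isCrosscutNhd_subset_ball hξ hρ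
    refine ⟨N, hN, eq_empty_of_subset_empty ?_⟩
    rintro _ ⟨hv, v, hvN, rfl⟩
    obtain ⟨s, hs, hsub⟩ := Metric.isOpen_iff.1 Metric.isOpen_ball v (hNρ hvN)
    exact hv ⟨s, hs, Sphere.AllInverseBranchesDefined.mono h (image_mono hsub)⟩
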